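/- For an integer $n\ge 0$ and $\alpha\in[-1,1]$ let $p_n(x;\alpha)=\sum_{j=0}^n c_j(\alpha)x^j$ be the minimax polynomial of the checkmark function, i.e. the best uniform approximation to $f(x)=|x-\alpha|$ on $[-1,1]$ among real polynomials of degree at most $n$, and let $E_n(\alpha)=\max_{x\in[-1,1]}\bigl||x-\alpha|-p_n(x;\alpha)\bigr|$ be the minimax error. The alternation set $\mathcal A_n(\alpha)$ is the set of all points that occur in some system $-1\le z_1<z_2<\dots<z_N\le 1$ with $N\ge n+2$ and $|z_i-\alpha|-p_n(z_i;\alpha)=\epsilon(-1)^iE_n(\alpha)$ for $i=1,\dots,N$, where $\epsilon\in\{1,-1\}$. A V-shape of $E_n$ with left endpoint $a$, tip $b$ and right endpoint $c$, where $-1\le a<b<c\le 1$, means that $E_n$ is affine and decreasing on $[a,b]$ and affine and increasing on $[b,c]$, and that $[a,c]$ is maximal: no strictly larger interval in $[-1,1]$ splits in the same way at some interior point. Theorem. Let $n\ge 0$ and let $\alpha_0\in(-1,1)$ be neither an endpoint nor the tip of a V-shape of $E_n$. Then: (1) $E_n$ is real analytic at $\alpha_0$. (2) There are functions $z_1,\dots,z_{n+2}$,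 real analytic at $\alpha_0$, such that for all $\alpha$ in a neighbourhood of $\alpha_0$ one has $z_1(\alpha)<\dots<z_{n+2}(\alpha)$ and $\mathcal A_n(\alpha)=\{z_1(\alpha),\dots,z_{n+2}(\alpha)\}$. (3) The coefficients $c_0,\dots,c_n$ of the minimax polynomial are real analytic at $\alpha_0$. -/

import Mathlib

open Set Filter Topology Polynomial

noncomputable section

namespace Checkmark

/-- The checkmark function `x ↦ |x - α|` as a continuous function on `[-1, 1]`. The norm on
`C(Icc (-1) 1, ℝ)` is the uniform norm. -/
def checkmark (α : ℝ) : C(Icc (-1 : ℝ) 1, ℝ) :=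
  ⟨fun x => |(x : ℝ) - α|, by fun_prop⟩

/-- `p` is a best uniform approximation to `|x - α|` on `[-1, 1]` among the real polynomials of
degree at most `n`. -/
def IsMinimax (n : ℕ) (α : ℝ) (p : ℝ[X]) : Prop :=
  p ∈ degreeLE ℝ n ∧
    ∀ q ∈ degreeLE ℝ n,
      ‖checkmark α - p.toContinuousMapOn (Icc (-1 : ℝ) 1)‖ ≤
        ‖checkmark α - q.toContinuousMapOn (Icc (-1 : ℝ) 1)‖

theorem exists_isMinimax (n : ℕ) (α : ℝ) : ∃ p, IsMinimax n α p := by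
  let L : ℝ[X] →ₗ[ℝ] C(Icc (-1 : ℝ) 1, ℝ) :=
    (toContinuousMapOnAlgHom (R := ℝ) (Icc (-1 : ℝ) 1)).toLinearMap
  have : FiniteDimensional ℝ (degreeLE ℝ (n : WithBot ℕ)) := by
    rw [degreeLE_eq_span_X_pow]
    exact FiniteDimensional.span_finset ℝ _
  let S := (degreeLE ℝ (n : WithBot ℕ)).map L
  have : ProperSpace S := FiniteDimensional.proper ℝ S
  have hcont : Continuous fun s : S => ‖checkmark α - (s : C(Icc (-1 : ℝ) 1, ℝ))‖ := by
    fun_prop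
  have hlim : Tendsto (fun s : S => ‖checkmark α - (s : C(Icc (-1 : ℝ) 1, ℝ))‖)
      (cocompact S) atTop := by
    refine tendsto_atTop_mono (f := fun s : S => ‖s‖ - ‖checkmark α‖) (fun s => ?_) ?_
    · have := norm_sub_norm_le (s : C(Icc (-1 : ℝ) 1, ℝ)) (checkmark α)
      rw [norm_sub_rev] at this
      exact this
    · exact tendsto_atTop_add_const_right _ _ (tendsto_norm_cocompact_atTop (E := S))
  obtain ⟨⟨_, p, hp, rfl⟩, hmin⟩ := hcont.exists_forall_le hlim
  exact ⟨p, hp, fun q hq => hmin ⟨L q, q, hq, rfl⟩⟩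

/-- The minimax polynomial `p_n(·; α)`. -/
def minimaxPoly (n : ℕ) (α : ℝ) : ℝ[X] :=
  (exists_isMinimax n α).choose

/-- The minimax error `E_n(α) = ‖|· - α| - p_n(·; α)‖`. -/
def minimaxError (n : ℕ) (α : ℝ) : ℝ :=
  ‖checkmark α - (minimaxPoly n α).toContinuousMapOn (Icc (-1 : ℝ) 1)‖

/-- `z 0 < z 1 < ⋯` are points of `[-1, 1]` at which the error `|x - α| - p_n(x; α)` takes the
values `± E_n(α)` with alternating signs. -/
def IsAlternation (n : ℕ) (α : ℝ) {N : ℕ} (z : Fin N → ℝ) : Prop :=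
  StrictMono z ∧ (∀ i, z i ∈ Icc (-1 : ℝ) 1) ∧
    ∃ ε : ℝ, (ε = 1 ∨ ε = -1) ∧
      ∀ i, |z i - α| - (minimaxPoly n α).eval (z i) =
        ε * (-1) ^ (i : ℕ) * minimaxError n α

/-- The alternation set `𝒜_n(α)`: all points that occur in an alternation of length at least
`n + 2`. -/
def alternationSet (n : ℕ) (α : ℝ) : Set ℝ :=
  {x | ∃ (N : ℕ) (z : Fin N → ℝ), n + 2 ≤ N ∧ IsAlternation n α z ∧ x ∈ range z}

/-- On `[a, c] ⊆ [-1, 1]` the function `g` is affine and decreasing on `[a, b]` and affine and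
increasing on `[b, c]`, where `a < b < c`. -/
structure IsVOn (g : ℝ → ℝ) (a b c : ℝ) : Prop where
  left_mem : -1 ≤ a
  left_lt : a < b
  lt_right : b < c
  right_mem : c ≤ 1
  decreasing : ∃ m k : ℝ, m < 0 ∧ ∀ x ∈ Icc a b, g x = m * x + k
  increasing : ∃ m k : ℝ, 0 < m ∧ ∀ x ∈ Icc b c, g x = m * x + k

/-- The graph of `g` over `[-1, 1]` has a V-shape with left endpoint `a`, tip `b` and right
endpoint `c`: the interval `[a, c]` is a maximal one on which `g` has the form of a V. -/
def IsVShape (g : ℝ → ℝ) (a b c : ℝ) : Prop :=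
  IsVOn g a b c ∧
    ∀ a' b' c', IsVOn g a' b' c' → a' ≤ a → c ≤ c' → a' = a ∧ c' = c

end Checkmark

end

open scoped ContDiff

namespace Checkmark

/-! ### Sign changes of polynomials -/

/-! For a corner `α` inside the interval, the best approximation `p` is unique and is characterised
by an error that alternates between `± E` at `n + 2` points (`IsMinimax.optimal`,
`Optimal.isMinimax`). Everything rests on a count of the critical points of the error on the whole
real line: left of the corner they satisfy `p' = -1`, right of it `p' = 1`. Rolle's theorem on each
side produces zeros of `p''`, whose degree is at most `n - 2`, so there are at most `n` critical
points, and further zeros of `p''` at these points or in the gap between the two sides lower the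
bound (`Optimal.card_crit_add_natDegree_le`, `Optimal.gap`). An extremal point is critical, an
endpoint or the corner, so there are `n + 2` or `n + 3` of them, and the corner is always one.

Two kinds of degeneration produce V-shapes. With `n + 3` extremal points, either the first or the
last can be dropped from the alternation. A dilation of the checkmark about the opposite endpoint of
the interval then keeps `p` optimal, so `E_n` is linear on both sides and `α` is a tip. If `1` is a
critical point, the error continued past `1` runs back to the opposite extremal value. Shrinking
towards `-1` brings that new extremal point to `1`: this gives a linear piece of `E_n` to the left
of `α`, starting at a tip, and it cannot continue beyond `α`. So `α` is a right endpoint; by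
reflection, a critical point at `-1` makes `α` a left endpoint.

In the remaining case (`exists_regular`) there are exactly `n + 2` extremal points, the error has
nonzero one-sided derivatives at the endpoints and the corner, and its critical extremal points have
`p'' ≠ 0`. Coefficients, signed error and alternation points then solve a square analytic system
with injective linearisation (`Regular.fderiv_system_injective`). Since they are continuous at `α₀`
(`tendsto_coeffs`, `Regular.eventually_alternates`), the implicit function theorem makes them
analytic. -/

/-- A polynomial of degree at most `n` cannot strictly alternate in sign at `n + 2` points. -/
theorem not_alternating {n : ℕ} {q : ℝ[X]} (hq : q.natDegree ≤ n) {z : Fin (n + 2) → ℝ}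
    (hz : StrictMono z)
    (h : ∀ i : Fin (n + 1), q.eval (z i.castSucc) * q.eval (z i.succ) < 0) : False := by
  have hroot : ∀ i : Fin (n + 1), ∃ w ∈ Ioo (z i.castSucc) (z i.succ), q.eval w = 0 := by
    intro i
    have hlt : z i.castSucc < z i.succ := hz (Fin.castSucc_lt_succ)
    have hc : ContinuousOn (fun x => q.eval x) (Icc (z i.castSucc) (z i.succ)) :=
      q.continuous.continuousOn
    rcases mul_neg_iff.1 (h i) with ⟨h1, h2⟩ | ⟨h1, h2⟩
    · obtain ⟨w, hw, hw0⟩ := intermediate_value_Ioo' hlt.le hc ⟨h2, h1⟩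
      exact ⟨w, hw, hw0⟩
    · obtain ⟨w, hw, hw0⟩ := intermediate_value_Ioo hlt.le hc ⟨h1, h2⟩
      exact ⟨w, hw, hw0⟩
  choose w hw hw0 using hroot
  have hwm : StrictMono w := by
    intro i j hij
    have : z i.succ ≤ z j.castSucc := hz.monotone (by
      rw [Fin.le_def]; simp; exact hij)
    exact (hw i).2.trans_le (this.trans (hw j).1.le)
  have hq0 : q = 0 := by
    refine eq_zero_of_natDegree_lt_card_of_eval_eq_zero q hwm.injective hw0 ?_
    simpa using Nat.lt_succ_of_le hq
  have := h 0
  simp [hq0] at this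

/-- If a continuous nonvanishing function on a compact set of reals changes sign along at most
`m` points, there is a polynomial of degree less than `m` with the same signs. -/
theorem exists_polynomial_same_sign (h : ℝ → ℝ) (m : ℕ) :
    ∀ S : Set ℝ, IsCompact S → ContinuousOn h S → (∀ x ∈ S, h x ≠ 0) →
      (¬ ∃ l : List ℝ, l.length = m + 1 ∧ (∀ x ∈ l, x ∈ S) ∧
        l.IsChain fun a b => a < b ∧ h a * h b < 0) →
      ∃ q : ℝ[X], q.degree < m ∧ (∀ x ∈ S, 0 < q.eval x * h x) ∧
        ∀ x, IsLeast S x → ∀ y ≤ x, 0 < q.eval y * h x := by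
  -- The last clause of the conclusion serves the induction: it controls the sign of `q` to the left
  -- of the set, where the next linear factor has to flip it.
  induction m with
  | zero =>
    intro S _ _ _ hl
    have hS : ∀ x, x ∉ S := fun x hx => hl ⟨[x], by simp, by simpa using hx, by simp⟩
    exact ⟨0, by simp, fun x hx => (hS x hx).elim, fun x hx => (hS x hx.1).elim⟩
  | succ m ih =>
    intro S hS hc h0 hl
    rcases S.eq_empty_or_nonempty with rfl | hne
    · exact ⟨0, by simp, by simp, fun x hx => (hx.1).elim⟩
    obtain ⟨s, hsS, hsl⟩ := hS.exists_isLeast hne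
    have hsmin : ∀ x, IsLeast S x → x = s := fun x hx => hx.unique ⟨hsS, hsl⟩
    have hs0 := h0 s hsS
    have hcs : ContinuousOn (fun x => h x * h s) S := hc.mul continuousOn_const
    have hT : IsCompact {x ∈ S | h x * h s ≤ 0} := by
      have := hcs.preimage_isClosed_of_isClosed hS.isClosed (isClosed_Iic (a := (0 : ℝ)))
      exact hS.of_isClosed_subset this inter_subset_left
    rcases {x ∈ S | h x * h s ≤ 0}.eq_empty_or_nonempty with hTe | hTne
    · have hpos : ∀ x ∈ S, 0 < h x * h s := fun x hx => by
        by_contra hcon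
        exact (Set.eq_empty_iff_forall_notMem.1 hTe x) ⟨hx, not_lt.1 hcon⟩
      refine ⟨C (h s), ?_, ?_, ?_⟩
      · exact degree_C_le.trans_lt (by exact_mod_cast Nat.succ_pos m)
      · intro x hx
        have := hpos x hx
        simpa [mul_comm] using this
      · intro x hx y _
        rw [hsmin x hx]
        simpa using hpos s hsS
    obtain ⟨t, ⟨htS, ht⟩, htl⟩ := hT.exists_isLeast hTne
    have htneg : h t * h s < 0 := lt_of_le_of_ne ht (mul_ne_zero (h0 t htS) hs0)
    have hst : s < t := by
      refine lt_of_le_of_ne (hsl htS) ?_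
      rintro rfl
      exact absurd htneg (not_lt.2 (mul_self_nonneg _))
    have hbelow : ∀ x ∈ S, x < t → 0 < h x * h s := by
      intro x hx hxt
      by_contra hcon
      exact absurd (htl ⟨hx, not_lt.1 hcon⟩) (not_le.2 hxt)
    have hU : IsCompact (S ∩ Ici t) := hS.inter_right isClosed_Ici
    have hl' : ¬ ∃ l : List ℝ, l.length = m + 1 ∧ (∀ x ∈ l, x ∈ S ∩ Ici t) ∧
        l.IsChain fun a b => a < b ∧ h a * h b < 0 := by
      rintro ⟨l, hlen, hmem, hch⟩
      obtain _ | ⟨a, l⟩ := l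
      · simp at hlen
      have ha := hmem a (by simp)
      have hmem' : ∀ x ∈ a :: l, x ∈ S := fun x hx => (hmem x hx).1
      -- A chain inside `S ∩ Ici t` can be lengthened in front: by `s` if it starts with the sign
      -- opposite to `h s`, otherwise by `t`.
      rcases lt_or_ge (h a * h s) 0 with has | has
      · refine hl ⟨s :: a :: l, by simpa using hlen, ?_, ?_⟩
        · intro x hx
          rcases List.mem_cons.1 hx with rfl | hx
          · exact hsS
          · exact hmem' x hx
        · rw [List.isChain_cons_cons]
          exact ⟨⟨hst.trans_le ha.2, by linarith⟩, hch⟩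
      · have has' : 0 < h a * h s := lt_of_le_of_ne has (mul_ne_zero (h0 a ha.1) hs0).symm
        have hta : t < a := by
          refine lt_of_le_of_ne ha.2 ?_
          rintro rfl
          linarith
        refine hl ⟨t :: a :: l, by simpa using hlen, ?_, ?_⟩
        · intro x hx
          rcases List.mem_cons.1 hx with rfl | hx
          · exact htS
          · exact hmem' x hx
        · rw [List.isChain_cons_cons]
          refine ⟨⟨hta, ?_⟩, hch⟩
          have h1 : (h t * h a) * (h s * h s) < 0 := by nlinarith
          exact (neg_iff_pos_of_mul_neg h1).2 (mul_self_pos.2 hs0)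
    obtain ⟨q, hqd, hqS, hql⟩ := ih (S ∩ Ici t) hU (hc.mono inter_subset_left)
      (fun x hx => h0 x hx.1) hl'
    have hqt := hql t ⟨⟨htS, self_mem_Ici⟩, fun x hx => hx.2⟩
    have hW : IsCompact {x ∈ S ∩ Iic t | 0 ≤ h x * h s} := by
      have := (hcs.mono (inter_subset_left (t := Iic t))).preimage_isClosed_of_isClosed
        (hS.isClosed.inter isClosed_Iic) (isClosed_Ici (a := (0 : ℝ)))
      exact hS.of_isClosed_subset this (inter_subset_left.trans inter_subset_left)
    obtain ⟨u, ⟨⟨huS, hut⟩, hu⟩, hug⟩ :=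
      hW.exists_isGreatest ⟨s, ⟨hsS, hst.le⟩, mul_self_nonneg _⟩
    have hut' : u < t := by
      refine lt_of_le_of_ne hut ?_
      rintro rfl
      exact absurd htneg (not_lt.2 hu)
    -- No point of `S` lies strictly between `u`, the last one before the first sign change, and
    -- `t`. Hence the factor `X - r` changes sign exactly where `h` first does.
    obtain ⟨r, hur, hrt⟩ := exists_between hut'
    have hleft : ∀ x ∈ S, x < t → ∀ y ≤ x, 0 < (q * (X - C r)).eval y * h x := by
      intro x hx hxt y hyx
      have hxu : x ≤ u := hug ⟨⟨hx, hxt.le⟩, (hbelow x hx hxt).le⟩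
      have h1 := hqt y (hyx.trans hxt.le)
      have h2 := hbelow x hx hxt
      have h3 : 0 < r - y := by linarith
      have h4 : 0 < ((q.eval y * (y - r)) * h x) * ((h s * h s) * (h t * h t)) := by
        have : 0 < (q.eval y * h t) * (r - y) * (h x * h s) * (-(h t * h s)) := by
          have : 0 < -(h t * h s) := by linarith
          positivity
        linarith
      have h5 : 0 < (h s * h s) * (h t * h t) :=
        mul_pos (mul_self_pos.2 hs0) (mul_self_pos.2 (h0 t htS))
      simpa using (pos_iff_pos_of_mul_pos h4).2 h5
    refine ⟨q * (X - C r), ?_, ?_, ?_⟩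
    · rw [degree_mul, degree_X_sub_C]
      push_cast
      exact WithBot.add_lt_add_right (by simp) hqd
    · intro x hx
      rcases lt_or_ge x t with hxt | hxt
      · exact hleft x hx hxt x le_rfl
      · have h1 := hqS x ⟨hx, hxt⟩
        have h2 : 0 < x - r := by linarith
        have : 0 < (q.eval x * h x) * (x - r) := by positivity
        simp only [eval_mul, eval_sub, eval_X, eval_C]
        linarith
    · intro x hx y hy
      rw [hsmin x hx] at hy ⊢
      exact hleft s hsS hst y hy

/-! ### The error function and the alternation theorem -/

/-- The error `|x - α| - p x`. -/
def err (α : ℝ) (p : ℝ[X]) (x : ℝ) : ℝ := |x - α| - p.eval x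

theorem continuous_err (α : ℝ) (p : ℝ[X]) : Continuous (err α p) := by
  unfold err
  fun_prop

theorem norm_sub_le_iff {α : ℝ} {p : ℝ[X]} {M : ℝ} :
    ‖checkmark α - p.toContinuousMapOn (Icc (-1 : ℝ) 1)‖ ≤ M ↔
      ∀ x ∈ Icc (-1 : ℝ) 1, |err α p x| ≤ M := by
  have : Nonempty (Icc (-1 : ℝ) 1) := ⟨⟨0, by norm_num, by norm_num⟩⟩
  rw [ContinuousMap.norm_le_of_nonempty]
  exact ⟨fun h x hx => h ⟨x, hx⟩, fun h x => h x x.2⟩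

theorem abs_err_le_norm (α : ℝ) (p : ℝ[X]) {x : ℝ} (hx : x ∈ Icc (-1 : ℝ) 1) :
    |err α p x| ≤ ‖checkmark α - p.toContinuousMapOn (Icc (-1 : ℝ) 1)‖ :=
  norm_sub_le_iff.1 le_rfl x hx

theorem exists_abs_err_eq_norm (α : ℝ) (p : ℝ[X]) :
    ∃ x ∈ Icc (-1 : ℝ) 1,
      |err α p x| = ‖checkmark α - p.toContinuousMapOn (Icc (-1 : ℝ) 1)‖ := by
  obtain ⟨x, hx, hmax⟩ := (isCompact_Icc (a := (-1 : ℝ)) (b := 1)).exists_isMaxOn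
    ⟨0, by norm_num⟩ (continuous_err α p).abs.continuousOn
  exact ⟨x, hx, le_antisymm (abs_err_le_norm α p hx) (norm_sub_le_iff.2 fun y hy => hmax hy)⟩

/-- The error of the approximation `p` takes the values `± E` alternately at the points `z`. -/
structure Alternates (α : ℝ) (p : ℝ[X]) (E : ℝ) {N : ℕ} (z : Fin N → ℝ) : Prop where
  strictMono : StrictMono z
  mem : ∀ i, z i ∈ Icc (-1 : ℝ) 1
  sign : ∃ ε : ℝ, (ε = 1 ∨ ε = -1) ∧ ∀ i, err α p (z i) = ε * (-1) ^ (i : ℕ) * E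

theorem Alternates.abs_err {α E : ℝ} {p : ℝ[X]} {N : ℕ} {z : Fin N → ℝ}
    (h : Alternates α p E z) (hE : 0 ≤ E) (i : Fin N) : |err α p (z i)| = E := by
  obtain ⟨ε, hε, hs⟩ := h.sign
  rw [hs, abs_mul, abs_mul, abs_pow, abs_neg, abs_one, one_pow, mul_one, abs_of_nonneg hE]
  rcases hε with rfl | rfl <;> simp

theorem Alternates.err_succ {α E : ℝ} {p : ℝ[X]} {N : ℕ} {z : Fin (N + 1) → ℝ}
    (h : Alternates α p E z) (i : Fin N) : err α p (z i.succ) = -err α p (z i.castSucc) := by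
  obtain ⟨ε, _, hs⟩ := h.sign
  rw [hs, hs]
  simp [pow_succ]

theorem Alternates.of_succ {α E : ℝ} {p : ℝ[X]} {N : ℕ} {z : Fin (N + 1) → ℝ}
    (hz : StrictMono z) (hm : ∀ i, z i ∈ Icc (-1 : ℝ) 1) (h0 : |err α p (z 0)| = E)
    (h : ∀ i : Fin N, err α p (z i.succ) = -err α p (z i.castSucc)) : Alternates α p E z := by
  refine ⟨hz, hm, ?_⟩
  have key : ∀ i, err α p (z i) = (-1) ^ (i : ℕ) * err α p (z 0) := by
    intro i
    induction i using Fin.induction with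
    | zero => simp
    | succ i ih => rw [h, ih]; simp [pow_succ]
  rcases abs_choice (err α p (z 0)) with h1 | h1
  · exact ⟨1, Or.inl rfl, fun i => by rw [key, ← h0, h1]; ring⟩
  · exact ⟨-1, Or.inr rfl, fun i => by rw [key, ← h0, h1]; ring⟩

/-- The certificate of optimality: `p` has degree at most `n`, its error is bounded by `E` on
`[-1, 1]` and alternates between `± E` at `n + 2` points. -/
structure Optimal (n : ℕ) (α : ℝ) (p : ℝ[X]) (E : ℝ) : Prop where
  natDegree_le : p.natDegree ≤ n
  pos : 0 < E
  abs_err_le : ∀ x ∈ Icc (-1 : ℝ) 1, |err α p x| ≤ E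
  alternates : ∃ z : Fin (n + 2) → ℝ, Alternates α p E z

theorem mem_degreeLE_iff {n : ℕ} {p : ℝ[X]} : p ∈ degreeLE ℝ n ↔ p.natDegree ≤ n := by
  rw [mem_degreeLE, natDegree_le_iff_degree_le]

theorem Optimal.isMinimax {n : ℕ} {α E : ℝ} {p : ℝ[X]} (h : Optimal n α p E) :
    IsMinimax n α p ∧ ‖checkmark α - p.toContinuousMapOn (Icc (-1 : ℝ) 1)‖ = E := by
  obtain ⟨z, hz⟩ := h.alternates
  have hnorm : ‖checkmark α - p.toContinuousMapOn (Icc (-1 : ℝ) 1)‖ = E :=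
    le_antisymm (norm_sub_le_iff.2 h.abs_err_le)
      ((hz.abs_err h.pos.le 0).ge.trans (abs_err_le_norm α p (hz.mem 0)))
  refine ⟨⟨mem_degreeLE_iff.2 h.natDegree_le, fun q hq => ?_⟩, hnorm⟩
  rw [hnorm]
  by_contra hlt
  rw [not_le] at hlt
  have hqE : ∀ i, |err α q (z i)| < E := fun i => (abs_err_le_norm α q (hz.mem i)).trans_lt hlt
  refine not_alternating (n := n) (q := p - q) ((natDegree_sub_le_of_le h.natDegree_le
    (mem_degreeLE_iff.1 hq)).trans (max_self n).le) hz.strictMono fun i => ?_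
  have hd : ∀ x, (p - q).eval x = err α q x - err α p x := by
    intro x
    simp [err]
  have h1 := abs_lt.1 (hqE i.castSucc)
  have h2 := abs_lt.1 (hqE i.succ)
  have h3 := hz.abs_err h.pos.le i.castSucc
  rw [hd, hd, hz.err_succ]
  rcases eq_or_eq_neg_of_abs_eq h3 with h4 | h4 <;> rw [h4]
  · exact mul_neg_of_neg_of_pos (by linarith) (by linarith)
  · exact mul_neg_of_pos_of_neg (by linarith) (by linarith)

/-- The error of a best approximation alternates at `n + 2` points. -/
theorem IsMinimax.optimal {n : ℕ} {α : ℝ} {p : ℝ[X]} (hp : IsMinimax n α p)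
    (hpos : 0 < ‖checkmark α - p.toContinuousMapOn (Icc (-1 : ℝ) 1)‖) :
    Optimal n α p ‖checkmark α - p.toContinuousMapOn (Icc (-1 : ℝ) 1)‖ := by
  set E := ‖checkmark α - p.toContinuousMapOn (Icc (-1 : ℝ) 1)‖ with hE
  have hle : ∀ x ∈ Icc (-1 : ℝ) 1, |err α p x| ≤ E := fun x hx => abs_err_le_norm α p hx
  refine ⟨mem_degreeLE_iff.1 hp.1, hpos, hle, ?_⟩
  let S := Icc (-1 : ℝ) 1 ∩ {x | |err α p x| = E}
  have hS : IsCompact S :=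
    isCompact_Icc.inter_right (isClosed_eq (continuous_err α p).abs continuous_const)
  have hS0 : ∀ x ∈ S, err α p x ≠ 0 := by
    intro x hx h0
    have := hx.2
    simp only [mem_ofPred_eq, h0, abs_zero] at this
    exact hpos.ne this
  by_cases hl : ∃ l : List ℝ, l.length = (n + 1) + 1 ∧ (∀ x ∈ l, x ∈ S) ∧
        l.IsChain fun a b => a < b ∧ err α p a * err α p b < 0
  · obtain ⟨l, hlen, hmem, hch⟩ := hl
    rw [List.isChain_iff_getElem] at hch
    refine ⟨fun i => l[(i : ℕ)]'(by omega), Alternates.of_succ ?_ ?_ ?_ ?_⟩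
    · rw [Fin.strictMono_iff_lt_succ]
      intro i
      exact (hch i (by omega)).1
    · intro i
      exact (hmem _ (List.getElem_mem _)).1
    · exact (hmem _ (List.getElem_mem _)).2
    · intro i
      have h1 := (hch i (by omega)).2
      have h2 : |err α p l[(i : ℕ)]| = E := (hmem _ (List.getElem_mem _)).2
      have h3 : |err α p l[(i : ℕ) + 1]| = E := (hmem _ (List.getElem_mem _)).2
      rcases abs_eq_abs.1 (h3.trans h2.symm) with h4 | h4
      · rw [h4] at h1
        exact absurd h1 (not_lt.2 (mul_self_nonneg _))
      · exact h4
  exfalso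
  obtain ⟨q, hqd, hq, -⟩ := exists_polynomial_same_sign (err α p) (n + 1) S hS
    (continuous_err α p).continuousOn hS0 hl
  have hqn : q.natDegree ≤ n := by
    rcases eq_or_ne q 0 with rfl | hq0
    · simp
    · rw [degree_eq_natDegree hq0] at hqd
      exact Nat.lt_succ_iff.1 (by exact_mod_cast hqd)
  -- Subtracting a small multiple of `q` lowers the error everywhere: near extremal points because
  -- `(e - τ q)² = e² + τ (τ q² - 2 q e)`, elsewhere by continuity. Membership is repeated as a
  -- premise because the local statements concern all nearby points of the line, while `|e| ≤ E`
  -- holds only on the interval.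
  have hev : ∀ᶠ τ in 𝓝 (0 : ℝ), ∀ x ∈ Icc (-1 : ℝ) 1, x ∈ Icc (-1 : ℝ) 1 → 0 < τ →
      |err α p x - τ * q.eval x| < E := by
    refine isCompact_Icc.eventually_forall_of_forall_eventually fun x hx => ?_
    have hce : Continuous fun w : ℝ × ℝ => err α p w.2 := (continuous_err α p).comp continuous_snd
    have hcq : Continuous fun w : ℝ × ℝ => q.eval w.2 := q.continuous.comp continuous_snd
    rcases (hle x hx).lt_or_eq with hlt | heq
    · have hcont : Continuous fun w : ℝ × ℝ => |err α p w.2 - w.1 * q.eval w.2| := by fun_prop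
      have := hcont.continuousAt.eventually_lt (x₀ := ((0 : ℝ), x)) (g := fun _ => E)
        continuousAt_const (by simpa using hlt)
      exact this.mono fun w hw _ _ => hw
    · have hpos' := hq x ⟨hx, heq⟩
      have hcont : Continuous fun w : ℝ × ℝ =>
          w.1 * (q.eval w.2) ^ 2 - 2 * (q.eval w.2 * err α p w.2) := by fun_prop
      have h1 := hcont.continuousAt.eventually_lt (x₀ := ((0 : ℝ), x)) (g := fun _ => 0)
        continuousAt_const (by simp; linarith)
      filter_upwards [h1] with w hw hwm hw0
      refine abs_lt_of_sq_lt_sq ?_ hpos.le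
      have h2 := sq_le_sq' (abs_le.1 (hle w.2 hwm)).1 (abs_le.1 (hle w.2 hwm)).2
      have h3 := mul_neg_of_pos_of_neg hw0 hw
      nlinarith
  obtain ⟨τ, hτ, hτ0⟩ := ((hev.filter_mono nhdsWithin_le_nhds).and
    (self_mem_nhdsWithin (a := (0 : ℝ)) (s := Ioi 0))).exists
  have hmin := hp.2 (p + C τ * q) (mem_degreeLE_iff.2 ((natDegree_add_le_of_degree_le
    (mem_degreeLE_iff.1 hp.1) ((natDegree_C_mul_le τ q).trans hqn))))
  obtain ⟨x, hx, hxe⟩ := exists_abs_err_eq_norm α (p + C τ * q)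
  rw [← hxe] at hmin
  have h1 := hτ x hx hx hτ0
  have h2 : err α (p + C τ * q) x = err α p x - τ * q.eval x := by
    simp [err]; ring
  rw [h2] at hmin
  exact absurd hmin (not_le.2 h1)

/-- A best approximation with positive error is unique. -/
theorem IsMinimax.unique {n : ℕ} {α : ℝ} {p q : ℝ[X]} (hp : IsMinimax n α p)
    (hq : IsMinimax n α q)
    (hpos : 0 < ‖checkmark α - p.toContinuousMapOn (Icc (-1 : ℝ) 1)‖) : p = q := by
  set E := ‖checkmark α - p.toContinuousMapOn (Icc (-1 : ℝ) 1)‖ with hE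
  have hEq : ‖checkmark α - q.toContinuousMapOn (Icc (-1 : ℝ) 1)‖ = E :=
    le_antisymm (hq.2 p hp.1) (hp.2 q hq.1)
  -- The midpoint is also a best approximation. Where its error is `± E`, both errors must have this
  -- same value, so `p` and `q` agree at `n + 2` points.
  let r : ℝ[X] := C (1 / 2) * (p + q)
  have hr : ∀ x, err α r x = (err α p x + err α q x) / 2 := by
    intro x
    simp [r, err]; ring
  have hpE : ∀ x ∈ Icc (-1 : ℝ) 1, |err α p x| ≤ E := fun x hx => abs_err_le_norm α p hx
  have hqE : ∀ x ∈ Icc (-1 : ℝ) 1, |err α q x| ≤ E := fun x hx =>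
    hEq ▸ abs_err_le_norm α q hx
  have hrd : r ∈ degreeLE ℝ n := mem_degreeLE_iff.2 ((natDegree_C_mul_le _ _).trans
    (natDegree_add_le_of_degree_le (mem_degreeLE_iff.1 hp.1) (mem_degreeLE_iff.1 hq.1)))
  have hrE : ‖checkmark α - r.toContinuousMapOn (Icc (-1 : ℝ) 1)‖ = E := by
    refine le_antisymm (norm_sub_le_iff.2 fun x hx => ?_) (hp.2 r hrd)
    have h1 := abs_le.1 (hpE x hx)
    have h2 := abs_le.1 (hqE x hx)
    rw [hr, abs_le]
    constructor <;> linarith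
  have hrm : IsMinimax n α r := ⟨hrd, fun s hs => hrE ▸ hp.2 s hs⟩
  obtain ⟨z, hz⟩ := (hrm.optimal (hrE ▸ hpos)).alternates
  have heq : ∀ i, (p - q).eval (z i) = 0 := by
    intro i
    have h0 := hz.abs_err (norm_nonneg _) i
    rw [hrE, hr] at h0
    have h1 := abs_le.1 (hpE _ (hz.mem i))
    have h2 := abs_le.1 (hqE _ (hz.mem i))
    have h3 : (p - q).eval (z i) = err α q (z i) - err α p (z i) := by simp [err]
    rw [h3]
    rcases eq_or_eq_neg_of_abs_eq h0 with h | h <;> linarith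
  have := eq_zero_of_natDegree_lt_card_of_eval_eq_zero (p - q) hz.strictMono.injective heq
    (by
      have := natDegree_sub_le_of_le (mem_degreeLE_iff.1 hp.1) (mem_degreeLE_iff.1 hq.1)
      rw [max_self] at this
      rw [Fintype.card_fin]
      omega)
  exact sub_eq_zero.1 this

theorem minimaxPoly_isMinimax (n : ℕ) (α : ℝ) : IsMinimax n α (minimaxPoly n α) :=
  (exists_isMinimax n α).choose_spec

theorem Optimal.eq_minimax {n : ℕ} {α E : ℝ} {p : ℝ[X]} (h : Optimal n α p E) :
    minimaxPoly n α = p ∧ minimaxError n α = E := by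
  have hp := h.isMinimax
  have : p = minimaxPoly n α := hp.1.unique (minimaxPoly_isMinimax n α) (hp.2 ▸ h.pos)
  exact ⟨this.symm, by rw [minimaxError, ← this, hp.2]⟩

/-- A checkmark with interior corner is not a polynomial. -/
theorem minimaxError_pos (n : ℕ) {α : ℝ} (hα : α ∈ Ioo (-1 : ℝ) 1) : 0 < minimaxError n α := by
  rw [minimaxError]
  set p := minimaxPoly n α
  refine lt_of_le_of_ne (norm_nonneg _) fun h0 => ?_
  have he : ∀ x ∈ Icc (-1 : ℝ) 1, p.eval x = |x - α| := by
    intro x hx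
    have h1 := abs_err_le_norm α p hx
    rw [← h0] at h1
    have h2 := abs_nonpos_iff.1 h1
    rw [err] at h2
    linarith
  have hright : p = X - C α := by
    refine eq_of_infinite_eval_eq _ _ ((Ioo_infinite hα.2).mono fun x hx => ?_)
    have : x ∈ Icc (-1 : ℝ) 1 := ⟨by linarith [hx.1, hα.1], hx.2.le⟩
    rw [mem_ofPred_eq, he x this, abs_of_pos (sub_pos.2 hx.1)]
    simp
  have h1 := he (-1) (by norm_num)
  rw [hright, abs_of_neg (by linarith [hα.1])] at h1
  simp at h1
  linarith [hα.1]

theorem optimal_minimaxPoly (n : ℕ) {α : ℝ} (hα : α ∈ Ioo (-1 : ℝ) 1) :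
    Optimal n α (minimaxPoly n α) (minimaxError n α) :=
  (minimaxPoly_isMinimax n α).optimal (minimaxError_pos n hα)

theorem norm_checkmark_sub_le (α β : ℝ) : ‖checkmark α - checkmark β‖ ≤ |α - β| := by
  rw [ContinuousMap.norm_le _ (abs_nonneg _)]
  intro x
  have := abs_abs_sub_abs_le_abs_sub ((x : ℝ) - α) (x - β)
  simp only [ContinuousMap.sub_apply, checkmark, ContinuousMap.coe_mk, Real.norm_eq_abs]
  refine this.trans (le_of_eq ?_)
  rw [abs_sub_comm α]
  congr 1
  ring

theorem continuous_checkmark : Continuous checkmark := by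
  refine LipschitzWith.continuous (K := 1) (LipschitzWith.of_dist_le_mul fun α β => ?_)
  rw [dist_eq_norm, Real.dist_eq]
  simpa using norm_checkmark_sub_le α β

theorem continuous_minimaxError (n : ℕ) : Continuous (minimaxError n) := by
  refine LipschitzWith.continuous (K := 1) (LipschitzWith.of_le_add fun α β => ?_)
  have h1 := (minimaxPoly_isMinimax n α).2 _ (minimaxPoly_isMinimax n β).1
  have h2 := norm_checkmark_sub_le α β
  have h3 := norm_add_le (checkmark β - (minimaxPoly n β).toContinuousMapOn (Icc (-1 : ℝ) 1))
    (checkmark α - checkmark β)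
  rw [show checkmark β - (minimaxPoly n β).toContinuousMapOn (Icc (-1 : ℝ) 1) +
    (checkmark α - checkmark β) = checkmark α - (minimaxPoly n β).toContinuousMapOn _ by abel] at h3
  rw [Real.dist_eq]
  exact h1.trans (h3.trans (add_le_add_right h2 _))

/-! ### Scaling and reflection -/

/-- The polynomial `s * p ((x + 1) / s - 1)`. -/
noncomputable def scalePoly (s : ℝ) (p : ℝ[X]) : ℝ[X] :=
  C s * p.comp (C s⁻¹ * (X + 1) - 1)

theorem natDegree_scalePoly_le (s : ℝ) (p : ℝ[X]) : (scalePoly s p).natDegree ≤ p.natDegree := by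
  refine (natDegree_C_mul_le _ _).trans (natDegree_comp_le.trans ?_)
  have : (C s⁻¹ * (X + 1) - 1 : ℝ[X]).natDegree ≤ 1 := by compute_degree
  simpa using Nat.mul_le_mul_left p.natDegree this

/-- The dilation about `-1` with ratio `s` multiplies `|x - α|` by `s`. This homogeneity is the
source of the linear pieces of `E_n`. -/
theorem err_scalePoly {s : ℝ} (hs : 0 < s) (α : ℝ) (p : ℝ[X]) (x : ℝ) :
    err (s * (α + 1) - 1) (scalePoly s p) (s * (x + 1) - 1) = s * err α p x := by
  have h1 : s * (x + 1) - 1 - (s * (α + 1) - 1) = s * (x - α) := by ring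
  have h2 : s⁻¹ * (s * (x + 1) - 1 + 1) - 1 = x := by field_simp; ring
  simp only [err, scalePoly, eval_mul, eval_C, eval_comp, eval_sub, eval_add, eval_X, eval_one]
  rw [h1, h2, abs_mul, abs_of_pos hs]
  ring

/-- Stretching the interval `[-1, 2 / s - 1]` to `[-1, 1]` preserves optimality, provided that it
contains the alternation and the error bound holds on it. -/
theorem Alternates.scale {n : ℕ} {α E s : ℝ} {p : ℝ[X]} {z : Fin (n + 2) → ℝ}
    (hz : StrictMono z) (hmem : ∀ i, -1 ≤ z i) (hE : 0 < E) (hp : p.natDegree ≤ n)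
    (hs : 0 < s) (hzs : ∀ i, s * (z i + 1) ≤ 2)
    (hsign : ∃ ε : ℝ, (ε = 1 ∨ ε = -1) ∧ ∀ i, err α p (z i) = ε * (-1) ^ (i : ℕ) * E)
    (hle : ∀ x, -1 ≤ x → s * (x + 1) ≤ 2 → |err α p x| ≤ E) :
    Optimal n (s * (α + 1) - 1) (scalePoly s p) (s * E) := by
  refine ⟨(natDegree_scalePoly_le s p).trans hp, mul_pos hs hE, ?_,
    fun i => s * (z i + 1) - 1, ?_, ?_, ?_⟩
  · intro x hx
    have hx' : x = s * (((x + 1) / s - 1) + 1) - 1 := by field_simp; ring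
    rw [hx', err_scalePoly hs, abs_mul, abs_of_pos hs]
    refine mul_le_mul_of_nonneg_left (hle _ ?_ ?_) hs.le
    · have : 0 ≤ (x + 1) / s := div_nonneg (by linarith [hx.1]) hs.le
      linarith
    · rw [sub_add_cancel, mul_div_cancel₀ _ hs.ne']
      linarith [hx.2]
  · intro i j hij
    have := mul_lt_mul_of_pos_left (hz hij) hs
    simp only
    linarith
  · intro i
    have : 0 ≤ s * (z i + 1) := mul_nonneg hs.le (by linarith [hmem i])
    exact ⟨by linarith, by linarith [hzs i]⟩
  · obtain ⟨ε, hε, h⟩ := hsign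
    refine ⟨ε, hε, fun i => ?_⟩
    rw [err_scalePoly hs, h]
    ring

theorem err_comp_neg (α : ℝ) (p : ℝ[X]) (x : ℝ) : err (-α) (p.comp (-X)) x = err α p (-x) := by
  simp only [err, eval_comp, eval_neg, eval_X]
  rw [← abs_neg (x - -α)]
  congr 2
  ring

theorem natDegree_comp_neg_le (p : ℝ[X]) : (p.comp (-X)).natDegree ≤ p.natDegree := by
  refine natDegree_comp_le.trans ?_
  simp

theorem Optimal.reflect {n : ℕ} {α E : ℝ} {p : ℝ[X]} (h : Optimal n α p E) :
    Optimal n (-α) (p.comp (-X)) E := by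
  refine ⟨(natDegree_comp_neg_le p).trans h.natDegree_le, h.pos, fun x hx => ?_, ?_⟩
  · rw [err_comp_neg]
    exact h.abs_err_le _ ⟨by linarith [hx.2], by linarith [hx.1]⟩
  · obtain ⟨z, hz⟩ := h.alternates
    refine ⟨fun i => -z i.rev, Alternates.of_succ ?_ ?_ ?_ ?_⟩
    · intro i j hij
      exact neg_lt_neg (hz.strictMono (Fin.rev_lt_rev.2 hij))
    · intro i
      have := hz.mem i.rev
      exact ⟨by linarith [this.2], by linarith [this.1]⟩
    · rw [err_comp_neg, neg_neg]
      exact hz.abs_err h.pos.le _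
    · intro i
      rw [err_comp_neg, err_comp_neg, neg_neg, neg_neg, Fin.rev_succ, Fin.rev_castSucc,
        hz.err_succ, neg_neg]

theorem minimaxError_neg (n : ℕ) (α : ℝ) : minimaxError n (-α) = minimaxError n α := by
  have key : ∀ α, minimaxError n (-α) ≤ minimaxError n α := by
    intro α
    refine ((minimaxPoly_isMinimax n (-α)).2 ((minimaxPoly n α).comp (-X)) (mem_degreeLE_iff.2
      ((natDegree_comp_neg_le _).trans (mem_degreeLE_iff.1 (minimaxPoly_isMinimax n α).1)))).trans
      (norm_sub_le_iff.2 fun x hx => ?_)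
    rw [err_comp_neg]
    exact abs_err_le_norm _ _ ⟨by linarith [hx.2], by linarith [hx.1]⟩
  refine le_antisymm (key α) ?_
  simpa using key (-α)

/-! ### Counting critical points of the error -/

/-- Rolle's theorem for a finite set of points at which a polynomial takes the same value. -/
theorem exists_derivative_roots_between (g : ℝ[X]) (c : ℝ) (S : Finset ℝ) (hS : S.Nonempty)
    (hg : ∀ x ∈ S, g.eval x = c) :
    ∃ Z : Finset ℝ, Z.card + 1 = S.card ∧ ∀ w ∈ Z, g.derivative.eval w = 0 ∧ w ∉ S ∧
      (∃ x ∈ S, x < w) ∧ ∃ y ∈ S, w < y := by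
  induction S using Finset.induction_on_max with
  | empty => exact absurd hS (by simp)
  | insert a S ha ih =>
    have haS : a ∉ S := fun h => lt_irrefl a (ha a h)
    rcases S.eq_empty_or_nonempty with rfl | hne
    · exact ⟨∅, by simp, by simp⟩
    obtain ⟨Z, hZ, hZr⟩ := ih hne fun x hx => hg x (Finset.mem_insert_of_mem hx)
    have hmax := S.max'_mem hne
    obtain ⟨w, hw, hw0⟩ := exists_hasDerivAt_eq_zero (ha _ hmax)
      g.continuous.continuousOn
      ((hg _ (Finset.mem_insert_of_mem hmax)).trans (hg a (Finset.mem_insert_self a S)).symm)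
      (fun x _ => g.hasDerivAt x)
    have hwZ : w ∉ Z := by
      intro h
      obtain ⟨-, -, -, y, hy, hwy⟩ := hZr w h
      exact absurd (hw.1.trans (hwy.trans_le (S.le_max' y hy))) (lt_irrefl _)
    refine ⟨insert w Z, ?_, ?_⟩
    · rw [Finset.card_insert_of_notMem hwZ, Finset.card_insert_of_notMem haS, hZ]
    · intro v hv
      rcases Finset.mem_insert.1 hv with rfl | hv
      · refine ⟨hw0, ?_, ⟨_, Finset.mem_insert_of_mem hmax, hw.1⟩, a,
          Finset.mem_insert_self a S, hw.2⟩
        intro h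
        rcases Finset.mem_insert.1 h with rfl | h
        · exact lt_irrefl _ hw.2
        · exact absurd (S.le_max' v h) (not_le.2 hw.1)
      · obtain ⟨h0, hvS, ⟨x, hx, hxv⟩, y, hy, hvy⟩ := hZr v hv
        refine ⟨h0, ?_, ⟨x, Finset.mem_insert_of_mem hx, hxv⟩, y, Finset.mem_insert_of_mem hy, hvy⟩
        intro h
        rcases Finset.mem_insert.1 h with rfl | h
        · exact lt_irrefl _ (hvy.trans (ha y hy))
        · exact hvS h

/-- The points of `Z` are roots of the cofactor `f / d`, because `d` does not vanish there. -/
theorem card_add_natDegree_le_of_roots {f d : ℝ[X]} (hf : f ≠ 0) (hd : d ∣ f) (Z : Finset ℝ)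
    (hZ : ∀ w ∈ Z, f.eval w = 0 ∧ d.eval w ≠ 0) : Z.card + d.natDegree ≤ f.natDegree := by
  obtain ⟨r, rfl⟩ := hd
  have hd0 : d ≠ 0 := left_ne_zero_of_mul hf
  have hr0 : r ≠ 0 := right_ne_zero_of_mul hf
  rw [natDegree_mul hd0 hr0, add_comm]
  refine Nat.add_le_add_left ?_ _
  by_contra hlt
  refine hr0 (eq_zero_of_natDegree_lt_card_of_eval_eq_zero' r Z (fun w hw => ?_) (not_le.1 hlt))
  have := hZ w hw
  rw [eval_mul] at this
  exact (mul_eq_zero.1 this.1).resolve_left this.2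

/-- To be used with `g = p'` when all critical points lie on one side. Rolle costs one point and
`p''` has degree at most `n - 2`, so the bound is strict; the Rolle points avoid `S` and hence the
roots of `d`. -/
theorem card_add_natDegree_lt {n : ℕ} {g d : ℝ[X]} {c : ℝ} (hg : g.derivative ≠ 0)
    (hdeg : g.derivative.natDegree + 2 ≤ n) {S : Finset ℝ} (hS : S.Nonempty)
    (hgS : ∀ x ∈ S, g.eval x = c) (hd : d ∣ g.derivative) (hdS : ∀ w, d.eval w = 0 → w ∈ S) :
    S.card + d.natDegree < n := by
  obtain ⟨Z, hZ, hZr⟩ := exists_derivative_roots_between g c S hS hgS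
  have := card_add_natDegree_le_of_roots hg hd Z fun w hw =>
    ⟨(hZr w hw).1, fun h => (hZr w hw).2.1 (hdS w h)⟩
  omega

/-- Rolle costs one point on each side, so equality is possible here. Roots of `d` may also lie in
the gap between the two sets, since Rolle points lie strictly within the span of `S` or of `T`. -/
theorem card_add_card_add_natDegree_le {n : ℕ} {g d : ℝ[X]} {c c' : ℝ} (hg : g.derivative ≠ 0)
    (hdeg : g.derivative.natDegree + 2 ≤ n) {S T : Finset ℝ} (hS : S.Nonempty) (hT : T.Nonempty)
    (hST : ∀ x ∈ S, ∀ y ∈ T, x < y)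
    (hgS : ∀ x ∈ S, g.eval x = c) (hgT : ∀ x ∈ T, g.eval x = c') (hd : d ∣ g.derivative)
    (hdS : ∀ w, d.eval w = 0 → w ∈ S ∨ w ∈ T ∨ ((∀ x ∈ S, x ≤ w) ∧ ∀ y ∈ T, w ≤ y)) :
    S.card + T.card + d.natDegree ≤ n := by
  obtain ⟨Z, hZ, hZr⟩ := exists_derivative_roots_between g c S hS hgS
  obtain ⟨W, hW, hWr⟩ := exists_derivative_roots_between g c' T hT hgT
  have hdis : Disjoint Z W := by
    rw [Finset.disjoint_left]
    intro w hwZ hwW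
    obtain ⟨-, -, -, y, hy, hwy⟩ := hZr w hwZ
    obtain ⟨-, -, ⟨x, hx, hxw⟩, -⟩ := hWr w hwW
    exact absurd (hST y hy x hx) (not_lt.2 (hxw.trans hwy).le)
  have := card_add_natDegree_le_of_roots hg hd (Z ∪ W) fun w hw => by
    rcases Finset.mem_union.1 hw with hw | hw
    · obtain ⟨h0, hwS, -, y, hy, hwy⟩ := hZr w hw
      refine ⟨h0, fun h => ?_⟩
      rcases hdS w h with h | h | h
      · exact hwS h
      · exact absurd (hST y hy w h) (not_lt.2 hwy.le)
      · exact absurd (h.1 y hy) (not_le.2 hwy)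
    · obtain ⟨h0, hwT, ⟨x, hx, hxw⟩, -⟩ := hWr w hw
      refine ⟨h0, fun h => ?_⟩
      rcases hdS w h with h | h | h
      · exact absurd (hST w h x hx) (not_lt.2 hxw.le)
      · exact hwT h
      · exact absurd (h.2 x hx) (not_le.2 hxw)
  rw [Finset.card_union_of_disjoint hdis] at this
  omega

theorem natDegree_derivative_derivative_add_two_le {n : ℕ} {p : ℝ[X]} (hp : p.natDegree ≤ n)
    (h : p.derivative.derivative ≠ 0) : p.derivative.derivative.natDegree + 2 ≤ n := by
  have h1 := natDegree_derivative_le p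
  have h2 := natDegree_derivative_le p.derivative
  have h3 : p.derivative.natDegree ≠ 0 := fun h0 => h (derivative_of_natDegree_zero h0)
  omega

/-- The critical points of the error, other than the corner. -/
def IsCrit (α : ℝ) (p : ℝ[X]) (x : ℝ) : Prop :=
  (x < α ∧ p.derivative.eval x = -1) ∨ (α < x ∧ p.derivative.eval x = 1)

theorem err_of_le {α x : ℝ} (p : ℝ[X]) (h : x ≤ α) : err α p x = (C α - X - p).eval x := by
  rw [err, abs_of_nonpos (by linarith)]
  simp

theorem err_of_ge {α x : ℝ} (p : ℝ[X]) (h : α ≤ x) : err α p x = (X - C α - p).eval x := by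
  rw [err, abs_of_nonneg (by linarith)]
  simp

theorem derivative_left (α : ℝ) (p : ℝ[X]) (x : ℝ) :
    (C α - X - p).derivative.eval x = -1 - p.derivative.eval x := by simp

theorem derivative_right (α : ℝ) (p : ℝ[X]) (x : ℝ) :
    (X - C α - p).derivative.eval x = 1 - p.derivative.eval x := by simp

theorem hasDerivAt_err_left {α x : ℝ} (p : ℝ[X]) (h : x < α) :
    HasDerivAt (err α p) (-1 - p.derivative.eval x) x := by
  rw [← derivative_left α]
  refine ((C α - X - p).hasDerivAt x).congr_of_eventuallyEq ?_
  filter_upwards [Iio_mem_nhds h] with y hy using err_of_le p (le_of_lt hy)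

theorem hasDerivAt_err_right {α x : ℝ} (p : ℝ[X]) (h : α < x) :
    HasDerivAt (err α p) (1 - p.derivative.eval x) x := by
  rw [← derivative_right α]
  refine ((X - C α - p).hasDerivAt x).congr_of_eventuallyEq ?_
  filter_upwards [Ioi_mem_nhds h] with y hy using err_of_ge p (le_of_lt hy)

/-- If `E` bounds the error on a neighbourhood of a point where it is attained, the error has a
local extremum there. -/
theorem isLocalExtr_err {α E x : ℝ} {p : ℝ[X]} (hle : ∀ᶠ y in 𝓝 x, |err α p y| ≤ E)
    (hx : |err α p x| = E) : IsLocalExtr (err α p) x := by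
  rcases abs_choice (err α p x) with h | h
  · right
    filter_upwards [hle] with y hy
    linarith [(abs_le.1 hy).2]
  · left
    filter_upwards [hle] with y hy
    linarith [(abs_le.1 hy).1]

theorem Optimal.eventually_abs_err_le {n : ℕ} {α E x : ℝ} {p : ℝ[X]} (h : Optimal n α p E)
    (hx : x ∈ Ioo (-1 : ℝ) 1) : ∀ᶠ y in 𝓝 x, |err α p y| ≤ E := by
  filter_upwards [Icc_mem_nhds hx.1 hx.2] with y hy using h.abs_err_le y hy

theorem Optimal.isCrit {n : ℕ} {α E x : ℝ} {p : ℝ[X]} (h : Optimal n α p E)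
    (hx : x ∈ Ioo (-1 : ℝ) 1) (hxα : x ≠ α) (hxe : |err α p x| = E) : IsCrit α p x := by
  have hex := isLocalExtr_err (h.eventually_abs_err_le hx) hxe
  rcases hxα.lt_or_gt with hlt | hlt
  · exact Or.inl ⟨hlt, by linarith [hex.hasDerivAt_eq_zero (hasDerivAt_err_left p hlt)]⟩
  · exact Or.inr ⟨hlt, by linarith [hex.hasDerivAt_eq_zero (hasDerivAt_err_right p hlt)]⟩

theorem exists_eq_of_derivative_eq_C {p : ℝ[X]} {c : ℝ} (h : p.derivative = C c) :
    ∃ k, p = C c * X + C k := by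
  have h1 : (p - C c * X).derivative = 0 := by simp [h]
  refine ⟨(p - C c * X).coeff 0, ?_⟩
  rw [← eq_C_of_natDegree_eq_zero (derivative_eq_zero.1 h1)]
  ring

theorem Alternates.mem_Ioo {n : ℕ} {α E : ℝ} {p : ℝ[X]} {z : Fin (n + 2) → ℝ}
    (hz : Alternates α p E z) (j : Fin n) : z j.succ.castSucc ∈ Ioo (-1 : ℝ) 1 := by
  constructor
  · exact (hz.mem 0).1.trans_lt (hz.strictMono (Fin.pos_iff_ne_zero.2 (by simp [Fin.ext_iff])))
  · exact (hz.strictMono (Fin.castSucc_lt_last _)).trans_le (hz.mem (Fin.last _)).2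

/-- The best approximation does not have slope `±1` throughout. -/
theorem Optimal.derivative_ne_C {n : ℕ} {α E c : ℝ} {p : ℝ[X]} (h : Optimal n α p E)
    (hc : c = 1 ∨ c = -1) : p.derivative ≠ C c := by
  intro hd
  have hc0 : c ≠ 0 := by rcases hc with rfl | rfl <;> norm_num
  obtain ⟨k, hk⟩ := exists_eq_of_derivative_eq_C hd
  obtain _ | m := n
  · have : p.derivative = 0 := derivative_of_natDegree_zero (Nat.le_zero.1 h.natDegree_le)
    rw [hd, C_eq_zero] at this
    exact hc0 this
  obtain ⟨z, hz⟩ := h.alternates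
  have hw := hz.mem_Ioo (0 : Fin (m + 1))
  set w := z (Fin.succ (0 : Fin (m + 1))).castSucc with hwdef
  have hwe : |err α p w| = E := hz.abs_err h.pos.le _
  have hcrit : w ≠ α → IsCrit α p w := fun hne => h.isCrit hw hne hwe
  have h01 := hz.err_succ 0
  have h12 := hz.err_succ (Fin.succ 0)
  rw [← hwdef] at h12
  have hlt0 : z (Fin.castSucc 0) < w := hz.strictMono Fin.castSucc_lt_succ
  have hlt2 : w < z (Fin.succ (Fin.succ 0)) := hz.strictMono Fin.castSucc_lt_succ
  have hw1 : w = z (Fin.succ 0) := rfl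
  rw [← hw1] at h01
  have hE := h.pos
  -- With slope `1` the error is constant to the right of the corner and has no critical points to
  -- the left. So the second alternation point is at or beyond the corner, and the error cannot
  -- change sign on the way to the third. Slope `-1` is the mirror image, with the first and second
  -- points.
  rcases hc with rfl | rfl
  · have hαw : α ≤ w := by
      by_contra hlt
      rcases hcrit (by linarith) with hh | hh
      · rw [hd] at hh
        norm_num at hh
      · exact hlt hh.1.le
    rw [err_of_ge p hαw, err_of_ge p (hαw.trans hlt2.le), hk] at h12
    rw [err_of_ge p hαw, hk] at hwe
    simp at h12 hwe
    rw [abs_eq hE.le] at hwe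
    rcases hwe with hh | hh <;> linarith
  · have hαw : w ≤ α := by
      by_contra hlt
      rcases hcrit (by linarith) with hh | hh
      · exact hlt hh.1.le
      · rw [hd] at hh
        norm_num at hh
    rw [err_of_le p hαw, err_of_le p (hlt0.le.trans hαw), hk] at h01
    rw [err_of_le p hαw, hk] at hwe
    simp at h01 hwe
    rw [abs_eq hE.le] at hwe
    rcases hwe with hh | hh <;> linarith

theorem Optimal.derivative_derivative_ne_zero {n : ℕ} {α E x : ℝ} {p : ℝ[X]}
    (h : Optimal n α p E) (hx : p.derivative.eval x = 1 ∨ p.derivative.eval x = -1) :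
    p.derivative.derivative ≠ 0 := by
  intro h0
  have h1 := eq_C_of_natDegree_eq_zero (derivative_eq_zero.1 h0)
  refine h.derivative_ne_C (c := p.derivative.coeff 0) ?_ h1
  rw [h1] at hx
  simpa using hx

open Classical in
/-- The critical points to the left of the corner. -/
noncomputable def critLeft (α : ℝ) (p : ℝ[X]) : Finset ℝ :=
  (p.derivative + 1).roots.toFinset.filter (· < α)

open Classical in
/-- The critical points to the right of the corner. -/
noncomputable def critRight (α : ℝ) (p : ℝ[X]) : Finset ℝ :=
  (p.derivative - 1).roots.toFinset.filter (α < ·)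

open Classical in
/-- All critical points of the error on the real line, other than the corner. -/
noncomputable def crit (α : ℝ) (p : ℝ[X]) : Finset ℝ := critLeft α p ∪ critRight α p

theorem Optimal.mem_critLeft {n : ℕ} {α E x : ℝ} {p : ℝ[X]} (h : Optimal n α p E) :
    x ∈ critLeft α p ↔ x < α ∧ p.derivative.eval x = -1 := by
  -- `roots` is empty by convention for the zero polynomial, so that case has to be excluded.
  have h0 : p.derivative + 1 ≠ 0 := fun h0 => h.derivative_ne_C (c := -1) (Or.inr rfl) (by
    rw [eq_neg_of_add_eq_zero_left h0]; simp)
  simp only [critLeft, Finset.mem_filter, Multiset.mem_toFinset, mem_roots h0, IsRoot, eval_add,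
    eval_one]
  rw [and_comm, add_eq_zero_iff_eq_neg]

theorem Optimal.mem_critRight {n : ℕ} {α E x : ℝ} {p : ℝ[X]} (h : Optimal n α p E) :
    x ∈ critRight α p ↔ α < x ∧ p.derivative.eval x = 1 := by
  have h0 : p.derivative - 1 ≠ 0 := fun h0 => h.derivative_ne_C (c := 1) (Or.inl rfl) (by
    rw [sub_eq_zero.1 h0]; simp)
  simp only [critRight, Finset.mem_filter, Multiset.mem_toFinset, mem_roots h0, IsRoot, eval_sub,
    eval_one]
  rw [and_comm, sub_eq_zero]

theorem Optimal.mem_crit {n : ℕ} {α E x : ℝ} {p : ℝ[X]} (h : Optimal n α p E) :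
    x ∈ crit α p ↔ IsCrit α p x := by
  rw [crit, Finset.mem_union, h.mem_critLeft, h.mem_critRight, IsCrit]

theorem Optimal.card_crit {n : ℕ} {α E : ℝ} {p : ℝ[X]} (h : Optimal n α p E) :
    (crit α p).card = (critLeft α p).card + (critRight α p).card := by
  rw [crit, Finset.card_union_of_disjoint]
  rw [Finset.disjoint_left]
  intro x hx hx'
  exact lt_asymm (h.mem_critLeft.1 hx).1 (h.mem_critRight.1 hx').1

/-- The fundamental count: critical points, together with multiple ones, number at most `n`. -/
theorem Optimal.card_crit_add_natDegree_le {n : ℕ} {α E : ℝ} {p d : ℝ[X]} (h : Optimal n α p E)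
    (hne : (crit α p).Nonempty) (hd : d ∣ p.derivative.derivative)
    (hdS : ∀ w, d.eval w = 0 → w ∈ crit α p) : (crit α p).card + d.natDegree ≤ n := by
  have h0 : p.derivative.derivative ≠ 0 := by
    obtain ⟨x, hx⟩ := hne
    rcases h.mem_crit.1 hx with hx | hx
    · exact h.derivative_derivative_ne_zero (Or.inr hx.2)
    · exact h.derivative_derivative_ne_zero (Or.inl hx.2)
  have hdeg := natDegree_derivative_derivative_add_two_le h.natDegree_le h0
  have hL : ∀ x ∈ critLeft α p, p.derivative.eval x = -1 := fun x hx => (h.mem_critLeft.1 hx).2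
  have hR : ∀ x ∈ critRight α p, p.derivative.eval x = 1 := fun x hx => (h.mem_critRight.1 hx).2
  rw [h.card_crit]
  simp only [crit, Finset.mem_union] at hdS
  rcases (critLeft α p).eq_empty_or_nonempty with hLe | hLn
  · have hRn : (critRight α p).Nonempty := by
      simpa [crit, hLe] using hne
    have := card_add_natDegree_lt h0 hdeg hRn hR hd (by simpa [hLe] using hdS)
    rw [hLe, Finset.card_empty]
    omega
  rcases (critRight α p).eq_empty_or_nonempty with hRe | hRn
  · have := card_add_natDegree_lt h0 hdeg hLn hL hd (by simpa [hRe] using hdS)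
    rw [hRe, Finset.card_empty]
    omega
  · refine card_add_card_add_natDegree_le h0 hdeg hLn hRn (fun x hx y hy =>
      (h.mem_critLeft.1 hx).1.trans (h.mem_critRight.1 hy).1) hL hR hd fun w hw => ?_
    rcases hdS w hw with hw | hw
    · exact Or.inl hw
    · exact Or.inr (Or.inl hw)

theorem Optimal.card_crit_le {n : ℕ} {α E : ℝ} {p : ℝ[X]} (h : Optimal n α p E) :
    (crit α p).card ≤ n := by
  rcases (crit α p).eq_empty_or_nonempty with he | hne
  · simp [he]
  · simpa using h.card_crit_add_natDegree_le hne (one_dvd _) (by simp)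

/-- If there are `n` critical points and `n ≥ 1`, they lie on both sides of the corner, and the
second derivative does not vanish between the two sides. -/
theorem Optimal.gap {n : ℕ} {α E : ℝ} {p : ℝ[X]} (h : Optimal n α p E) {S T : Finset ℝ}
    (hST : ∀ x ∈ S, ∀ y ∈ T, x < y) (hS : ∀ x ∈ S, p.derivative.eval x = -1)
    (hT : ∀ y ∈ T, p.derivative.eval y = 1) (hcard : n ≤ S.card + T.card) (hn : 0 < S.card + T.card) :
    ∃ (hS : S.Nonempty) (hT : T.Nonempty), ∀ w ∈ Icc (S.max' hS) (T.min' hT),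
      0 < p.derivative.derivative.eval w := by
  have h0 : p.derivative.derivative ≠ 0 := by
    rcases S.eq_empty_or_nonempty with rfl | ⟨x, hx⟩
    · obtain ⟨y, hy⟩ : T.Nonempty := by
        rw [← Finset.card_pos]; simpa using hn
      exact h.derivative_derivative_ne_zero (Or.inl (hT y hy))
    · exact h.derivative_derivative_ne_zero (Or.inr (hS x hx))
  have hdeg := natDegree_derivative_derivative_add_two_le h.natDegree_le h0
  have hSn : S.Nonempty := by
    by_contra hcon
    rw [Finset.not_nonempty_iff_eq_empty] at hcon
    subst hcon
    have hTn : T.Nonempty := by rw [← Finset.card_pos]; simpa using hn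
    have := card_add_natDegree_lt h0 hdeg hTn hT (one_dvd _) (by simp)
    simp at this hcard
    omega
  have hTn : T.Nonempty := by
    by_contra hcon
    rw [Finset.not_nonempty_iff_eq_empty] at hcon
    subst hcon
    have := card_add_natDegree_lt h0 hdeg hSn hS (one_dvd _) (by simp)
    simp at this hcard
    omega
  refine ⟨hSn, hTn, ?_⟩
  -- A zero `w` of `p''` in the gap could be counted through `d = X - w`, exceeding `n`. The sign is
  -- then read off from one point: `p'` rises from `-1` to `1` across the gap.
  have hne : ∀ w ∈ Icc (S.max' hSn) (T.min' hTn), p.derivative.derivative.eval w ≠ 0 := by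
    intro w hw hw0
    have := card_add_card_add_natDegree_le (d := X - C w) h0 hdeg hSn hTn hST hS hT
      (dvd_iff_isRoot.2 hw0) fun v hv => by
        have : v = w := by simpa [sub_eq_zero] using hv
        subst this
        exact Or.inr (Or.inr ⟨fun x hx => (S.le_max' x hx).trans hw.1,
          fun y hy => hw.2.trans (T.min'_le y hy)⟩)
    rw [natDegree_X_sub_C] at this
    omega
  have hlt := hST _ (S.max'_mem hSn) _ (T.min'_mem hTn)
  obtain ⟨v, hv, hv'⟩ := exists_hasDerivAt_eq_slope (fun x => p.derivative.eval x)
    (fun x => p.derivative.derivative.eval x) hlt p.derivative.continuous.continuousOn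
    (fun x _ => p.derivative.hasDerivAt x)
  rw [hS _ (S.max'_mem hSn), hT _ (T.min'_mem hTn)] at hv'
  have hvpos : 0 < p.derivative.derivative.eval v := by
    rw [hv']
    exact div_pos (by norm_num) (sub_pos.2 hlt)
  intro w hw
  by_contra hneg
  have hwneg := lt_of_le_of_ne (not_lt.1 hneg) (hne w hw)
  have hsub : uIcc w v ⊆ Icc (S.max' hSn) (T.min' hTn) :=
    ordConnected_Icc.uIcc_subset hw (Ioo_subset_Icc_self hv)
  obtain ⟨u, hu, hu0⟩ := intermediate_value_uIcc
    (p.derivative.derivative.continuous.continuousOn (s := uIcc w v))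
    (mem_uIcc.2 (Or.inl ⟨hwneg.le, hvpos.le⟩))
  exact hne u (hsub hu) hu0

theorem strictAntiOn_err_left {α a b : ℝ} {p : ℝ[X]} (hb : b ≤ α)
    (h : ∀ x ∈ Ioo a b, -1 < p.derivative.eval x) : StrictAntiOn (err α p) (Icc a b) := by
  refine strictAntiOn_of_deriv_neg (convex_Icc a b) (continuous_err α p).continuousOn fun x hx => ?_
  rw [interior_Icc] at hx
  rw [(hasDerivAt_err_left p (hx.2.trans_le hb)).deriv]
  linarith [h x hx]

theorem strictMonoOn_err_right {α a b : ℝ} {p : ℝ[X]} (ha : α ≤ a)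
    (h : ∀ x ∈ Ioo a b, p.derivative.eval x < 1) : StrictMonoOn (err α p) (Icc a b) := by
  refine strictMonoOn_of_deriv_pos (convex_Icc a b) (continuous_err α p).continuousOn
    fun x hx => ?_
  rw [interior_Icc] at hx
  rw [(hasDerivAt_err_right p (ha.trans_lt hx.1)).deriv]
  linarith [h x hx]

theorem strictAntiOn_err_right {α a b : ℝ} {p : ℝ[X]} (ha : α ≤ a)
    (h : ∀ x ∈ Ioo a b, 1 < p.derivative.eval x) : StrictAntiOn (err α p) (Icc a b) := by
  refine strictAntiOn_of_deriv_neg (convex_Icc a b) (continuous_err α p).continuousOn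
    fun x hx => ?_
  rw [interior_Icc] at hx
  rw [(hasDerivAt_err_right p (ha.trans_lt hx.1)).deriv]
  linarith [h x hx]

theorem strictMonoOn_eval_of_derivative_pos {g : ℝ[X]} {a b : ℝ}
    (h : ∀ x ∈ Icc a b, 0 < g.derivative.eval x) :
    StrictMonoOn (fun x => g.eval x) (Icc a b) := by
  refine strictMonoOn_of_deriv_pos (convex_Icc a b) g.continuous.continuousOn fun x hx => ?_
  rw [Polynomial.deriv]
  exact h x (interior_subset hx)

/-! ### The extremal points of the error -/

/-- The corner belongs to every alternation of length `n + 2`. -/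
theorem Optimal.exists_eq_corner {n : ℕ} {α E : ℝ} {p : ℝ[X]} (h : Optimal n α p E)
    (hα : α ∈ Ioo (-1 : ℝ) 1) {z : Fin (n + 2) → ℝ} (hz : Alternates α p E z) :
    ∃ i, z i = α := by
  by_contra! hne
  have hze := hz.abs_err h.pos.le
  have hαE := abs_le.1 (h.abs_err_le α (Ioo_subset_Icc_self hα))
  have hcr : ∀ i, z i ∈ Ioo (-1 : ℝ) 1 → z i ∈ crit α p := fun i hi =>
    h.mem_crit.2 (h.isCrit hi (hne i) (hze i))
  -- For `n = 0` the points would be `-1` and `1`, which forces `p = 1`. Its error at the corner has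
  -- modulus `1`, more than `E = |α|`.
  rcases Nat.eq_zero_or_pos n with rfl | hn
  · have hcard := h.card_crit_le
    have hemp : crit α p = ∅ := Finset.card_eq_zero.1 (Nat.le_zero.1 hcard)
    have hend : ∀ i, z i = -1 ∨ z i = 1 := by
      intro i
      by_contra! hcon
      have := hcr i ⟨lt_of_le_of_ne (hz.mem i).1 hcon.1.symm, lt_of_le_of_ne (hz.mem i).2 hcon.2⟩
      simp [hemp] at this
    have hlt : z 0 < z 1 := hz.strictMono (by simp)
    have h0 : z 0 = -1 := by
      rcases hend 0 with h0 | h0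
      · exact h0
      · linarith [(hz.mem 1).2]
    have h1 : z 1 = 1 := by
      rcases hend 1 with h1 | h1
      · linarith
      · exact h1
    have hs := hz.err_succ 0
    have ha := hze 0
    rw [show Fin.succ (0 : Fin 1) = 1 from rfl, show Fin.castSucc (0 : Fin 1) = 0 from rfl, h0, h1]
      at hs
    rw [h0] at ha
    obtain ⟨k, hk⟩ : ∃ k, p = C k := ⟨_, eq_C_of_natDegree_eq_zero (Nat.le_zero.1 h.natDegree_le)⟩
    rw [err_of_le p hα.1.le] at ha hs
    rw [err_of_ge p hα.2.le] at hs
    rw [err_of_le p le_rfl] at hαE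
    simp only [hk, eval_sub, eval_C, eval_X] at ha hs hαE
    rcases abs_choice (α - -1 - k) with hh | hh <;> rw [hh] at ha <;> linarith [hα.1, hα.2]
  -- Without the corner, the `n` inner points are critical, hence they are all the critical points.
  -- By the gap lemma the error falls from the last one on the left to the corner and rises to the
  -- first one on the right. These two are consecutive in the alternation, so one has the value
  -- `-E`, and the corner lies below it.
  let y : Fin n → ℝ := fun j => z j.succ.castSucc
  have hyinj : Function.Injective y := by
    intro a b hab
    have := hz.strictMono.injective hab
    simpa using this
  have hsub : Finset.univ.image y ⊆ crit α p := by
    intro x hx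
    obtain ⟨j, -, rfl⟩ := Finset.mem_image.1 hx
    exact hcr _ (hz.mem_Ioo j)
  have hcardy : (Finset.univ.image y).card = n := by
    rw [Finset.card_image_of_injective _ hyinj]; simp
  have heq : Finset.univ.image y = crit α p :=
    Finset.eq_of_subset_of_card_le hsub (by rw [hcardy]; exact h.card_crit_le)
  have hcc := h.card_crit
  rw [← heq, hcardy] at hcc
  obtain ⟨hL, hR, hpos⟩ := h.gap (S := critLeft α p) (T := critRight α p)
    (fun x hx y hy => (h.mem_critLeft.1 hx).1.trans (h.mem_critRight.1 hy).1)
    (fun x hx => (h.mem_critLeft.1 hx).2) (fun x hx => (h.mem_critRight.1 hx).2)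
    hcc.le (by omega)
  set a := (critLeft α p).max' hL with ha
  set b := (critRight α p).min' hR with hb
  have haL := h.mem_critLeft.1 ((critLeft α p).max'_mem hL)
  have hbR := h.mem_critRight.1 ((critRight α p).min'_mem hR)
  rw [← ha] at haL
  rw [← hb] at hbR
  have hmono := strictMonoOn_eval_of_derivative_pos hpos
  have hab : a < b := haL.1.trans hbR.1
  have hanti : err α p α < err α p a := by
    refine strictAntiOn_err_left le_rfl (fun x hx => ?_) ⟨le_rfl, haL.1.le⟩ ⟨haL.1.le, le_rfl⟩ haL.1
    rw [← haL.2]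
    exact hmono ⟨le_rfl, hab.le⟩ ⟨hx.1.le, hx.2.le.trans hbR.1.le⟩ hx.1
  have hmono' : err α p α < err α p b := by
    refine strictMonoOn_err_right le_rfl (fun x hx => ?_) ⟨le_rfl, hbR.1.le⟩ ⟨hbR.1.le, le_rfl⟩
      hbR.1
    rw [← hbR.2]
    exact hmono ⟨haL.1.le.trans hx.1.le, hx.2.le⟩ ⟨hab.le, le_rfl⟩ hx.2
  obtain ⟨j, -, hj⟩ := Finset.mem_image.1 (heq ▸ h.mem_crit.2 (Or.inl haL))
  obtain ⟨k, -, hk⟩ := Finset.mem_image.1 (heq ▸ h.mem_crit.2 (Or.inr hbR))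
  have hjk : j < k := by
    by_contra hcon
    have : y k ≤ y j := hz.strictMono.monotone (by simpa using hcon)
    rw [hj, hk] at this
    exact absurd hab (not_lt.2 this)
  have hle : z j.succ.succ ≤ b := by
    rw [← hk]
    refine hz.strictMono.monotone ?_
    rw [Fin.le_def]
    simpa using hjk
  have hgt : a < z j.succ.succ := by
    rw [← hj]
    exact hz.strictMono Fin.castSucc_lt_succ
  have hb1 : b < 1 := hk ▸ (hz.mem_Ioo k).2
  have ha1 : -1 < a := hj ▸ (hz.mem_Ioo j).1
  have hnext : z j.succ.succ = b := by
    refine le_antisymm hle (not_lt.1 fun hlt => ?_)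
    rcases h.mem_crit.1 (hcr j.succ.succ ⟨ha1.trans hgt, hlt.trans hb1⟩) with hc | hc
    · exact absurd ((critLeft α p).le_max' _ (h.mem_critLeft.2 hc)) (not_le.2 hgt)
    · exact absurd ((critRight α p).min'_le _ (h.mem_critRight.2 hc)) (not_le.2 hlt)
  have hs := hz.err_succ j.succ
  have hea := hze j.succ.castSucc
  change z j.succ.castSucc = a at hj
  rw [hnext, hj] at hs
  rw [hj] at hea
  rcases eq_or_eq_neg_of_abs_eq hea with hh | hh <;> linarith

open Classical in
/-- The set of points of `[-1, 1]` at which the error attains its maximal modulus. -/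
noncomputable def extr (α : ℝ) (p : ℝ[X]) (E : ℝ) : Finset ℝ :=
  (insert α (insert (-1) (insert 1 (crit α p)))).filter
    fun x => x ∈ Icc (-1 : ℝ) 1 ∧ |err α p x| = E

theorem Optimal.mem_extr {n : ℕ} {α E x : ℝ} {p : ℝ[X]} (h : Optimal n α p E) :
    x ∈ extr α p E ↔ x ∈ Icc (-1 : ℝ) 1 ∧ |err α p x| = E := by
  rw [extr, Finset.mem_filter, and_iff_right_iff_imp]
  rintro ⟨hx, hxe⟩
  simp only [Finset.mem_insert]
  by_contra! hcon
  exact hcon.2.2.2 (h.mem_crit.2 (h.isCrit ⟨lt_of_le_of_ne hx.1 hcon.2.1.symm,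
    lt_of_le_of_ne hx.2 hcon.2.2.1⟩ hcon.1 hxe))

theorem Optimal.alternates_mem_extr {n N : ℕ} {α E : ℝ} {p : ℝ[X]} (h : Optimal n α p E)
    {z : Fin N → ℝ} (hz : Alternates α p E z) (i : Fin N) : z i ∈ extr α p E :=
  h.mem_extr.2 ⟨hz.mem i, hz.abs_err h.pos.le i⟩

theorem Optimal.corner_mem_extr {n : ℕ} {α E : ℝ} {p : ℝ[X]} (h : Optimal n α p E)
    (hα : α ∈ Ioo (-1 : ℝ) 1) : α ∈ extr α p E := by
  obtain ⟨z, hz⟩ := h.alternates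
  obtain ⟨i, rfl⟩ := h.exists_eq_corner hα hz
  exact h.alternates_mem_extr hz i

theorem Optimal.le_card_extr {n : ℕ} {α E : ℝ} {p : ℝ[X]} (h : Optimal n α p E) :
    n + 2 ≤ (extr α p E).card := by
  obtain ⟨z, hz⟩ := h.alternates
  have : Finset.univ.image z ⊆ extr α p E := by
    intro x hx
    obtain ⟨i, -, rfl⟩ := Finset.mem_image.1 hx
    exact h.alternates_mem_extr hz i
  refine le_trans ?_ (Finset.card_le_card this)
  rw [Finset.card_image_of_injective _ hz.strictMono.injective]
  simp

theorem extr_subset (α E : ℝ) (p : ℝ[X]) :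
    extr α p E ⊆ insert α (insert (-1) (insert 1 (crit α p))) :=
  fun _ hx => by
    rw [extr, Finset.mem_filter] at hx
    convert hx.1

theorem Optimal.card_extr_le {n : ℕ} {α E : ℝ} {p : ℝ[X]} (h : Optimal n α p E) :
    (extr α p E).card ≤ n + 3 := by
  have h1 := Finset.card_le_card (extr_subset α E p)
  have h2 := Finset.card_insert_le α (insert (-1) (insert 1 (crit α p)))
  have h3 := Finset.card_insert_le (-1) (insert 1 (crit α p))
  have h4 := Finset.card_insert_le 1 (crit α p)
  have := h.card_crit_le
  omega

/-- Between two points on the same side of the corner where the error agrees there is a critical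
point. -/
theorem exists_isCrit_between {α x y : ℝ} {p : ℝ[X]} (hxy : x < y) (hside : y ≤ α ∨ α ≤ x)
    (he : err α p x = err α p y) : ∃ w ∈ Ioo x y, IsCrit α p w := by
  rcases hside with hy | hx
  · obtain ⟨w, hw, hw0⟩ := exists_hasDerivAt_eq_zero hxy (continuous_err α p).continuousOn he
      (fun v hv => hasDerivAt_err_left p (hv.2.trans_le hy))
    exact ⟨w, hw, Or.inl ⟨hw.2.trans_le hy, by linarith⟩⟩
  · obtain ⟨w, hw, hw0⟩ := exists_hasDerivAt_eq_zero hxy (continuous_err α p).continuousOn he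
      (fun v hv => hasDerivAt_err_right p (hx.trans_lt hv.1))
    exact ⟨w, hw, Or.inr ⟨hx.trans_lt hw.1, by linarith⟩⟩

/-- If all critical points are extremal, the error alternates at the sequence of all extremal
points. -/
theorem Optimal.alternates_orderEmb {n N : ℕ} {α E : ℝ} {p : ℝ[X]} (h : Optimal n α p E)
    (hα : α ∈ Ioo (-1 : ℝ) 1) (hcrit : crit α p ⊆ extr α p E)
    (hN : (extr α p E).card = N + 1) : Alternates α p E ((extr α p E).orderEmbOfFin hN) := by
  set z := (extr α p E).orderEmbOfFin hN with hz
  have hmem : ∀ i, z i ∈ extr α p E := fun i => Finset.orderEmbOfFin_mem _ _ i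
  have hsurj : ∀ x ∈ extr α p E, ∃ i, z i = x := by
    intro x hx
    have : x ∈ Set.range z := by
      rw [hz, Finset.range_orderEmbOfFin]
      exact hx
    exact this
  have hadj : ∀ i : Fin N, ∀ x ∈ extr α p E, ¬ (z i.castSucc < x ∧ x < z i.succ) := by
    rintro i x hx ⟨h1, h2⟩
    obtain ⟨k, rfl⟩ := hsurj x hx
    rw [z.lt_iff_lt] at h1 h2
    rw [Fin.lt_def] at h1 h2
    simp at h1 h2
    omega
  refine Alternates.of_succ z.strictMono (fun i => (h.mem_extr.1 (hmem i)).1)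
    (h.mem_extr.1 (hmem 0)).2 fun i => ?_
  have h1 := (h.mem_extr.1 (hmem i.castSucc)).2
  have h2 := (h.mem_extr.1 (hmem i.succ)).2
  -- The corner is extremal, so neighbouring points lie on one side of it. Equal values would give a
  -- critical, hence extremal, point strictly between neighbours.
  rcases abs_eq_abs.1 (h2.trans h1.symm) with h3 | h3
  · exfalso
    have hside : z i.succ ≤ α ∨ α ≤ z i.castSucc := by
      by_contra! hcon
      exact hadj i α (h.corner_mem_extr hα) ⟨hcon.2, hcon.1⟩
    obtain ⟨w, hw, hwc⟩ := exists_isCrit_between (z.strictMono Fin.castSucc_lt_succ) hside h3.symm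
    exact hadj i w (hcrit (h.mem_crit.2 hwc)) hw
  · exact h3

/-! ### Nondegeneracy -/

/-- At a local extremum of a polynomial a zero of the second derivative is a multiple one. -/
theorem sq_dvd_derivative_derivative_of_isLocalExtr {f : ℝ[X]} {c : ℝ}
    (hext : IsLocalExtr (fun x => f.eval x) c) (h2 : f.derivative.derivative.eval c = 0) :
    (X - C c) ^ 2 ∣ f.derivative.derivative := by
  have h1 : f.derivative.eval c = 0 := hext.hasDerivAt_eq_zero (f.hasDerivAt c)
  obtain ⟨a, ha⟩ := dvd_iff_isRoot.2 (show (f - C (f.eval c)).IsRoot c by simp)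
  have hf : f = (X - C c) * a + C (f.eval c) := by rw [← ha]; ring
  have ha0 : a.eval c = 0 := by
    rw [hf] at h1
    simpa using h1
  obtain ⟨b, rfl⟩ := dvd_iff_isRoot.2 ha0
  have hb0 : b.eval c = 0 := by
    rw [hf] at h2
    simpa using h2
  obtain ⟨k, rfl⟩ := dvd_iff_isRoot.2 hb0
  have hval : ∀ x, f.eval x - f.eval c = (x - c) ^ 3 * k.eval x := by
    intro x
    have := congrArg (eval x) ha
    simp at this
    rw [this]
    ring
  -- The cube changes sign at `c` but `f - f(c)` does not, so `k` must vanish there. This makes a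
  -- fourfold zero, of which two derivatives leave a double one.
  have hk0 : k.eval c = 0 := by
    have hkr : Tendsto (fun x => k.eval x) (𝓝[>] c) (𝓝 (k.eval c)) :=
      k.continuous.continuousAt.tendsto.mono_left nhdsWithin_le_nhds
    have hkl : Tendsto (fun x => k.eval x) (𝓝[<] c) (𝓝 (k.eval c)) :=
      k.continuous.continuousAt.tendsto.mono_left nhdsWithin_le_nhds
    rcases hext with hmin | hmax
    · refine le_antisymm (le_of_tendsto hkl ?_) (ge_of_tendsto hkr ?_)
      · filter_upwards [hmin.filter_mono nhdsWithin_le_nhds, self_mem_nhdsWithin] with x hx hxc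
        have h3 : (x - c) ^ 3 < 0 := Odd.pow_neg (by decide) (sub_neg.2 hxc)
        by_contra hcon
        have := mul_neg_of_neg_of_pos h3 (not_le.1 hcon)
        linarith [hval x]
      · filter_upwards [hmin.filter_mono nhdsWithin_le_nhds, self_mem_nhdsWithin] with x hx hxc
        have h3 : 0 < (x - c) ^ 3 := pow_pos (sub_pos.2 hxc) 3
        by_contra hcon
        have := mul_neg_of_pos_of_neg h3 (not_le.1 hcon)
        linarith [hval x]
    · refine le_antisymm (le_of_tendsto hkr ?_) (ge_of_tendsto hkl ?_)
      · filter_upwards [hmax.filter_mono nhdsWithin_le_nhds, self_mem_nhdsWithin] with x hx hxc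
        have h3 : 0 < (x - c) ^ 3 := pow_pos (sub_pos.2 hxc) 3
        by_contra hcon
        have := mul_pos h3 (not_le.1 hcon)
        linarith [hval x]
      · filter_upwards [hmax.filter_mono nhdsWithin_le_nhds, self_mem_nhdsWithin] with x hx hxc
        have h3 : (x - c) ^ 3 < 0 := Odd.pow_neg (by decide) (sub_neg.2 hxc)
        by_contra hcon
        have := mul_pos_of_neg_of_neg h3 (not_le.1 hcon)
        linarith [hval x]
  obtain ⟨r, rfl⟩ := dvd_iff_isRoot.2 hk0
  have hd : (X - C c) ^ 4 ∣ f - C (f.eval c) := ⟨r, by rw [ha]; ring⟩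
  have := pow_sub_one_dvd_derivative_of_pow_dvd (pow_sub_one_dvd_derivative_of_pow_dvd hd)
  simpa using this

/-- A zero of `p''` at `c` would enter the count as `d = X - c` and bring it above `n`. -/
theorem Optimal.derivative_derivative_ne_zero_of_card_eq {n : ℕ} {α E c : ℝ} {p : ℝ[X]}
    (h : Optimal n α p E) (hc : c ∈ crit α p) (hcard : n ≤ (crit α p).card) :
    p.derivative.derivative.eval c ≠ 0 := by
  intro h0
  have := h.card_crit_add_natDegree_le ⟨c, hc⟩ (dvd_iff_isRoot.2 h0) fun w hw => by
    have : w = c := by simpa [sub_eq_zero] using hw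
    rwa [this]
  rw [natDegree_X_sub_C] at this
  omega

/-- With one critical point fewer, a simple zero of `p''` would fit into the count. At a local
extremum of the error, however, the zero is at least double, and `d = (X - c) ^ 2` is too much. -/
theorem Optimal.derivative_derivative_ne_zero_of_extr {n : ℕ} {α E c : ℝ} {p : ℝ[X]}
    (h : Optimal n α p E) (hc : c ∈ crit α p) (hcI : c ∈ Ioo (-1 : ℝ) 1) (hce : |err α p c| = E)
    (hcard : n ≤ (crit α p).card + 1) : p.derivative.derivative.eval c ≠ 0 := by
  intro h0
  have hex := isLocalExtr_err (h.eventually_abs_err_le hcI) hce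
  have hd : (X - C c) ^ 2 ∣ p.derivative.derivative := by
    rcases h.mem_crit.1 hc with hlt | hlt
    · have hev : (fun x => err α p x) =ᶠ[𝓝 c] fun x => (C α - X - p).eval x := by
        filter_upwards [Iio_mem_nhds hlt.1] with y hy using err_of_le p (le_of_lt hy)
      have := sq_dvd_derivative_derivative_of_isLocalExtr (hex.congr hev)
        (by simpa using h0)
      simpa using this
    · have hev : (fun x => err α p x) =ᶠ[𝓝 c] fun x => (X - C α - p).eval x := by
        filter_upwards [Ioi_mem_nhds hlt.1] with y hy using err_of_ge p (le_of_lt hy)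
      have := sq_dvd_derivative_derivative_of_isLocalExtr (hex.congr hev)
        (by simpa using h0)
      simpa using this
  have := h.card_crit_add_natDegree_le ⟨c, hc⟩ hd fun w hw => by
    have : w = c := by simpa [sub_eq_zero] using hw
    rwa [this]
  rw [natDegree_pow, natDegree_X_sub_C] at this
  omega

/-- If `p' = 1` at the corner, it can be counted among the right critical points, which restores the
number `n` needed for the gap lemma. Then `p'' > 0` from the last left critical point up to the
corner and slightly beyond, so the error is strictly decreasing through the corner, which is
nevertheless extremal. -/
theorem Optimal.derivative_corner_ne_one {n : ℕ} {α E : ℝ} {p : ℝ[X]} (h : Optimal n α p E)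
    (hα : α ∈ Ioo (-1 : ℝ) 1) (hcard : n ≤ (crit α p).card + 1) : p.derivative.eval α ≠ 1 := by
  intro h1
  have hαR : α ∉ critRight α p := fun hh => lt_irrefl _ (h.mem_critRight.1 hh).1
  have hcc := h.card_crit
  have hins : (insert α (critRight α p)).card = (critRight α p).card + 1 :=
    Finset.card_insert_of_notMem hαR
  obtain ⟨hL, hR, hpos⟩ := h.gap (S := critLeft α p) (T := insert α (critRight α p))
    (fun x hx y hy => by
      rcases Finset.mem_insert.1 hy with rfl | hy
      · exact (h.mem_critLeft.1 hx).1
      · exact (h.mem_critLeft.1 hx).1.trans (h.mem_critRight.1 hy).1)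
    (fun x hx => (h.mem_critLeft.1 hx).2)
    (fun x hx => by
      rcases Finset.mem_insert.1 hx with rfl | hx
      · exact h1
      · exact (h.mem_critRight.1 hx).2)
    (by omega) (by omega)
  have hmin : (insert α (critRight α p)).min' hR = α := by
    refine le_antisymm (Finset.min'_le _ _ (Finset.mem_insert_self _ _))
      (Finset.le_min' _ _ _ fun y hy => ?_)
    rcases Finset.mem_insert.1 hy with rfl | hy
    · exact le_rfl
    · exact (h.mem_critRight.1 hy).1.le
  rw [hmin] at hpos
  set a := (critLeft α p).max' hL with ha
  have haL := h.mem_critLeft.1 ((critLeft α p).max'_mem hL)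
  rw [← ha] at haL
  have hmono := strictMonoOn_eval_of_derivative_pos hpos
  have hanti : StrictAntiOn (err α p) (Icc a α) := by
    refine strictAntiOn_err_left le_rfl fun x hx => ?_
    rw [← haL.2]
    exact hmono ⟨le_rfl, haL.1.le⟩ ⟨hx.1.le, hx.2.le⟩ hx.1
  have hev : ∀ᶠ y in 𝓝 α, 0 < p.derivative.derivative.eval y :=
    p.derivative.derivative.continuous.continuousAt.eventually (lt_mem_nhds
      (hpos α ⟨haL.1.le, le_rfl⟩))
  obtain ⟨ε, hε, hball⟩ := Metric.eventually_nhds_iff_ball.1 hev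
  obtain ⟨b, hb1, hb2⟩ : ∃ b, α < b ∧ b < min 1 (α + ε) :=
    exists_between (lt_min hα.2 (by linarith))
  have hb3 := hb2.trans_le (min_le_left _ _)
  have hb4 := hb2.trans_le (min_le_right _ _)
  have hmonoR := strictMonoOn_eval_of_derivative_pos (g := p.derivative) (a := α) (b := b)
    fun x hx => hball x (by
      rw [Metric.mem_ball, Real.dist_eq, abs_lt]
      constructor <;> linarith [hx.1, hx.2])
  have hantiR : err α p b < err α p α := by
    refine strictAntiOn_err_right le_rfl (fun x hx => ?_) ⟨le_rfl, hb1.le⟩ ⟨hb1.le, le_rfl⟩ hb1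
    rw [← h1]
    exact hmonoR ⟨le_rfl, hb1.le⟩ ⟨hx.1.le, hx.2.le⟩ hx.1
  obtain ⟨a', ha1, ha2⟩ : ∃ a', max (-1) a < a' ∧ a' < α :=
    exists_between (max_lt hα.1 haL.1)
  have ha3 := (le_max_left _ _).trans_lt ha1
  have ha4 := (le_max_right _ _).trans_lt ha1
  have hantiL : err α p α < err α p a' := hanti ⟨ha4.le, ha2.le⟩ ⟨haL.1.le, le_rfl⟩ ha2
  have hA := abs_le.1 (h.abs_err_le a' ⟨ha3.le, by linarith [hα.2]⟩)
  have hB := abs_le.1 (h.abs_err_le b ⟨by linarith [hα.1], hb3.le⟩)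
  rcases eq_or_eq_neg_of_abs_eq (h.mem_extr.1 (h.corner_mem_extr hα)).2 with hh | hh <;> linarith

theorem derivative_comp_neg_eval (p : ℝ[X]) (x : ℝ) :
    (p.comp (-X)).derivative.eval x = -p.derivative.eval (-x) := by
  rw [derivative_comp]
  simp

theorem isCrit_comp_neg {α x : ℝ} {p : ℝ[X]} :
    IsCrit (-α) (p.comp (-X)) x ↔ IsCrit α p (-x) := by
  simp only [IsCrit, derivative_comp_neg_eval, neg_eq_iff_eq_neg, neg_neg, lt_neg, neg_lt]
  exact or_comm

theorem Optimal.crit_comp_neg {n : ℕ} {α E : ℝ} {p : ℝ[X]} (h : Optimal n α p E) :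
    crit (-α) (p.comp (-X)) = (crit α p).map (Equiv.neg ℝ).toEmbedding := by
  ext x
  rw [h.reflect.mem_crit, isCrit_comp_neg, ← h.mem_crit, Finset.mem_map_equiv]
  simp

theorem Optimal.extr_comp_neg {n : ℕ} {α E : ℝ} {p : ℝ[X]} (h : Optimal n α p E) :
    extr (-α) (p.comp (-X)) E = (extr α p E).map (Equiv.neg ℝ).toEmbedding := by
  ext x
  rw [h.reflect.mem_extr, err_comp_neg, Finset.mem_map_equiv, Equiv.neg_symm, Equiv.neg_apply,
    h.mem_extr]
  simp only [mem_Icc, neg_le_neg_iff, neg_le (b := x)]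
  constructor <;> rintro ⟨⟨h1, h2⟩, h3⟩ <;> exact ⟨⟨by linarith, by linarith⟩, h3⟩

theorem Optimal.derivative_corner_ne_neg_one {n : ℕ} {α E : ℝ} {p : ℝ[X]} (h : Optimal n α p E)
    (hα : α ∈ Ioo (-1 : ℝ) 1) (hcard : n ≤ (crit α p).card + 1) : p.derivative.eval α ≠ -1 := by
  intro h1
  refine h.reflect.derivative_corner_ne_one ⟨by linarith [hα.2], by linarith [hα.1]⟩ ?_ ?_
  · rwa [h.crit_comp_neg, Finset.card_map]
  · rw [derivative_comp_neg_eval, neg_neg, h1, neg_neg]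

/-! ### V-shapes -/

theorem affine_unique {m k m' k' a b : ℝ} (hab : a < b)
    (h : ∀ x ∈ Icc a b, m * x + k = m' * x + k') : m = m' ∧ k = k' := by
  have h1 := h a ⟨le_rfl, hab.le⟩
  have h2 := h b ⟨hab.le, le_rfl⟩
  have h3 : (m - m') * (b - a) = 0 := by linarith
  have h4 : m = m' := by
    rcases mul_eq_zero.1 h3 with h | h <;> linarith
  subst h4
  exact ⟨rfl, by linarith⟩

/-- Otherwise the decreasing piece of the first V and the increasing piece of the second would
overlap in an interval. -/
theorem IsVOn.tip_le {g : ℝ → ℝ} {a b c a' b' c' : ℝ} (h : IsVOn g a b c) (h' : IsVOn g a' b' c')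
    (hc : b < c') : b ≤ b' := by
  by_contra hlt
  rw [not_le] at hlt
  obtain ⟨m, k, hm, hd⟩ := h.decreasing
  obtain ⟨m', k', hm', hi⟩ := h'.increasing
  have := affine_unique (max_lt h.left_lt hlt) fun x hx =>
    (hd x ⟨(le_max_left _ _).trans hx.1, hx.2⟩).symm.trans
      (hi x ⟨(le_max_right _ _).trans hx.1, hx.2.trans hc.le⟩)
  linarith [this.1]

/-- For even functions V-shapes come in mirror pairs. -/
theorem IsVOn.reflect {g : ℝ → ℝ} (hg : ∀ x, g (-x) = g x) {a b c : ℝ} (h : IsVOn g a b c) :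
    IsVOn g (-c) (-b) (-a) := by
  obtain ⟨m, k, hm, hd⟩ := h.decreasing
  obtain ⟨m', k', hm', hi⟩ := h.increasing
  refine ⟨by linarith [h.right_mem], by linarith [h.lt_right], by linarith [h.left_lt],
    by linarith [h.left_mem], ⟨-m', k', by linarith, fun x hx => ?_⟩,
    ⟨-m, k, by linarith, fun x hx => ?_⟩⟩
  · rw [← hg, hi (-x) ⟨by linarith [hx.2], by linarith [hx.1]⟩]
    ring
  · rw [← hg, hd (-x) ⟨by linarith [hx.2], by linarith [hx.1]⟩]
    ring

theorem IsVShape.reflect {g : ℝ → ℝ} (hg : ∀ x, g (-x) = g x) {a b c : ℝ}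
    (h : IsVShape g a b c) : IsVShape g (-c) (-b) (-a) := by
  refine ⟨h.1.reflect hg, fun a' b' c' h' ha hc => ?_⟩
  have := h.2 (-c') (-b') (-a') (h'.reflect hg) (by linarith) (by linarith)
  exact ⟨by linarith [this.2], by linarith [this.1]⟩

theorem IsVOn.tip_eq {g : ℝ → ℝ} {a b c a' b' c' : ℝ} (h : IsVOn g a b c)
    (h' : IsVOn g a' b' c') (ha : a' ≤ a) (hc : c ≤ c') : b' = b := by
  refine le_antisymm (not_lt.1 fun hlt => ?_) (h.tip_le h' (h.lt_right.trans_le hc))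
  obtain ⟨m, k, hm, hi⟩ := h.increasing
  obtain ⟨m', k', hm', hd⟩ := h'.decreasing
  have := affine_unique (lt_min h.lt_right hlt) fun x hx =>
    (hi x ⟨hx.1, hx.2.trans (min_le_left _ _)⟩).symm.trans
      (hd x ⟨(ha.trans h.left_lt.le).trans hx.1, hx.2.trans (min_le_right _ _)⟩)
  linarith [this.1]

/-- Every V of a continuous function extends to a maximal one with the same tip. -/
theorem IsVOn.exists_isVShape {g : ℝ → ℝ} (hg : Continuous g) {a b c : ℝ} (h : IsVOn g a b c) :
    ∃ a' c', a' ≤ a ∧ c ≤ c' ∧ IsVShape g a' b c' := by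
  obtain ⟨m, k, hm, hd⟩ := h.decreasing
  obtain ⟨m', k', hm', hi⟩ := h.increasing
  have hclosed : ∀ m k : ℝ, IsClosed {x | g x = m * x + k} := fun m k =>
    isClosed_eq hg (by fun_prop)
  -- Leaving out the outer endpoint lets the formulas pass to `sInf A` and `sSup B` by exhaustion;
  -- continuity adds the endpoints afterwards.
  let A := {x | x ∈ Icc (-1) a ∧ ∀ y ∈ Ioc x b, g y = m * y + k}
  let B := {x | x ∈ Icc c 1 ∧ ∀ y ∈ Ico b x, g y = m' * y + k'}
  have haA : a ∈ A := ⟨⟨h.left_mem, le_rfl⟩, fun y hy => hd y ⟨hy.1.le, hy.2⟩⟩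
  have hcB : c ∈ B := ⟨⟨le_rfl, h.right_mem⟩, fun y hy => hi y ⟨hy.1, hy.2.le⟩⟩
  have hAb : BddBelow A := ⟨-1, fun x hx => hx.1.1⟩
  have hBb : BddAbove B := ⟨1, fun x hx => hx.1.2⟩
  have ha0 : sInf A ≤ a := csInf_le hAb haA
  have hc0 : c ≤ sSup B := le_csSup hBb hcB
  have hAa : ∀ y ∈ Icc (sInf A) b, g y = m * y + k := by
    have hlt : sInf A < b := ha0.trans_lt h.left_lt
    have : Ioc (sInf A) b ⊆ {x | g x = m * x + k} := by
      intro y hy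
      obtain ⟨x, hx, hxy⟩ := exists_lt_of_csInf_lt ⟨a, haA⟩ hy.1
      exact hx.2 y ⟨hxy, hy.2⟩
    have := closure_minimal this (hclosed m k)
    rwa [closure_Ioc hlt.ne] at this
  have hBa : ∀ y ∈ Icc b (sSup B), g y = m' * y + k' := by
    have hlt : b < sSup B := h.lt_right.trans_le hc0
    have : Ico b (sSup B) ⊆ {x | g x = m' * x + k'} := by
      intro y hy
      obtain ⟨x, hx, hxy⟩ := exists_lt_of_lt_csSup ⟨c, hcB⟩ hy.2
      exact hx.2 y ⟨hy.1, hxy⟩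
    have := closure_minimal this (hclosed m' k')
    rwa [closure_Ico hlt.ne] at this
  have hV : IsVOn g (sInf A) b (sSup B) :=
    ⟨le_csInf ⟨a, haA⟩ fun x hx => hx.1.1, ha0.trans_lt h.left_lt, h.lt_right.trans_le hc0,
      csSup_le ⟨c, hcB⟩ fun x hx => hx.1.2, ⟨m, k, hm, hAa⟩, ⟨m', k', hm', hBa⟩⟩
  refine ⟨sInf A, sSup B, ha0, hc0, hV, fun a' b' c' h' ha hc => ?_⟩
  have hb : b' = b := hV.tip_eq h' ha hc
  subst hb
  obtain ⟨μ, κ, -, hd'⟩ := h'.decreasing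
  obtain ⟨μ', κ', -, hi'⟩ := h'.increasing
  obtain ⟨rfl, rfl⟩ := affine_unique hV.left_lt fun x hx =>
    (hAa x hx).symm.trans (hd' x ⟨ha.trans hx.1, hx.2⟩)
  obtain ⟨rfl, rfl⟩ := affine_unique hV.lt_right fun x hx =>
    (hBa x hx).symm.trans (hi' x ⟨hx.1, hx.2.trans hc⟩)
  refine ⟨le_antisymm ha (csInf_le hAb ⟨⟨h'.left_mem, ha.trans ha0⟩, fun y hy =>
    hd' y ⟨hy.1.le, hy.2⟩⟩), le_antisymm (le_csSup hBb ⟨⟨hc0.trans hc, h'.right_mem⟩,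
    fun y hy => hi' y ⟨hy.1, hy.2.le⟩⟩) hc⟩

/-! ### Tips -/

/-- If an alternation avoids the right endpoint, the minimax error increases linearly to the
right of the corner. -/
theorem Optimal.exists_affine_right {n : ℕ} {α E : ℝ} {p : ℝ[X]} (h : Optimal n α p E)
    (hα : α ∈ Ioo (-1 : ℝ) 1) {z : Fin (n + 2) → ℝ} (hz : Alternates α p E z)
    (hlt : ∀ i, z i < 1) :
    ∃ c, α < c ∧ c ≤ 1 ∧ ∀ x ∈ Icc α c, minimaxError n x = E / (α + 1) * (x + 1) := by
  have hα1 : 0 < α + 1 := by linarith [hα.1]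
  set t := z (Fin.last _) with ht
  have hzt : ∀ i, z i ≤ t := fun i => hz.strictMono.monotone (Fin.le_last i)
  obtain ⟨j, hj⟩ := h.exists_eq_corner hα hz
  have hαt : α ≤ t := hj ▸ hzt j
  have ht1 : t < 1 := hlt _
  have htp : 0 < t + 1 := by linarith [hα.1]
  -- The image of the corner under the dilation about `-1` that carries the last alternation point
  -- `t` to `1`.
  refine ⟨2 / (t + 1) * (α + 1) - 1, ?_, ?_, fun x hx => ?_⟩
  · have : 1 < 2 / (t + 1) := by rw [lt_div_iff₀ htp]; linarith
    nlinarith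
  · have : 2 / (t + 1) * (α + 1) ≤ 2 := by
      rw [div_mul_eq_mul_div, div_le_iff₀ htp]; linarith
    linarith
  · set s := (x + 1) / (α + 1) with hs
    have hs1 : 1 ≤ s := by rw [hs, le_div_iff₀ hα1]; linarith [hx.1]
    have hs0 : 0 < s := by linarith
    have hxs : s * (α + 1) - 1 = x := by rw [hs, div_mul_cancel₀ _ hα1.ne']; ring
    have hst : s ≤ 2 / (t + 1) := by
      rw [hs, div_le_iff₀ hα1]; linarith [hx.2]
    have hst' : s * (t + 1) ≤ 2 := (le_div_iff₀ htp).1 hst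
    have hopt := Alternates.scale hz.strictMono (fun i => (hz.mem i).1) h.pos h.natDegree_le hs0
      (fun i => (mul_le_mul_of_nonneg_left (by linarith [hzt i]) hs0.le).trans hst') hz.sign
      (fun y hy1 hy2 => h.abs_err_le y ⟨hy1, by nlinarith⟩)
    rw [hxs] at hopt
    rw [hopt.eq_minimax.2, hs]
    ring

theorem Optimal.extr_eq_of_card {n : ℕ} {α E : ℝ} {p : ℝ[X]} (h : Optimal n α p E)
    (hcard : n + 3 ≤ (extr α p E).card) :
    extr α p E = insert α (insert (-1) (insert 1 (crit α p))) := by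
  refine Finset.eq_of_subset_of_card_le (extr_subset α E p) ?_
  have h2 := Finset.card_insert_le α (insert (-1) (insert 1 (crit α p)))
  have h3 := Finset.card_insert_le (-1) (insert 1 (crit α p))
  have h4 := Finset.card_insert_le 1 (crit α p)
  have := h.card_crit_le
  omega

/-- All candidates are extremal, so the error alternates at `n + 3` points; without the last one
there remain `n + 2` points below `1`. -/
theorem Optimal.exists_affine_right_of_card {n : ℕ} {α E : ℝ} {p : ℝ[X]} (h : Optimal n α p E)
    (hα : α ∈ Ioo (-1 : ℝ) 1) (hcard : n + 3 ≤ (extr α p E).card) :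
    ∃ c, α < c ∧ c ≤ 1 ∧ ∀ x ∈ Icc α c, minimaxError n x = E / (α + 1) * (x + 1) := by
  have heq := h.extr_eq_of_card hcard
  have hcard' : (extr α p E).card = (n + 2) + 1 := le_antisymm h.card_extr_le hcard
  have hsub : crit α p ⊆ extr α p E := by
    rw [heq]
    intro x hx
    simp [hx]
  have hZ := h.alternates_orderEmb hα hsub hcard'
  set Z := (extr α p E).orderEmbOfFin hcard'
  refine h.exists_affine_right hα (z := fun i => Z i.castSucc) ⟨?_, fun i => hZ.mem _, ?_⟩ ?_
  · exact fun i j hij => hZ.strictMono (Fin.castSucc_lt_castSucc_iff.2 hij)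
  · obtain ⟨ε, hε, hs⟩ := hZ.sign
    exact ⟨ε, hε, fun i => hs _⟩
  · exact fun i => (hZ.strictMono (Fin.castSucc_lt_last i)).trans_le (hZ.mem _).2

/-- If there are `n + 3` extremal points, the corner is the tip of a V. -/
theorem Optimal.exists_isVOn_of_card {n : ℕ} {α E : ℝ} {p : ℝ[X]} (h : Optimal n α p E)
    (hα : α ∈ Ioo (-1 : ℝ) 1) (hcard : n + 3 ≤ (extr α p E).card) :
    ∃ a c, IsVOn (minimaxError n) a α c := by
  obtain ⟨c, hc, hc1, hR⟩ := h.exists_affine_right_of_card hα hcard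
  obtain ⟨a, ha, ha1, hL⟩ := h.reflect.exists_affine_right_of_card
    ⟨by linarith [hα.2], by linarith [hα.1]⟩ (by rwa [h.extr_comp_neg, Finset.card_map])
  have h1 : 0 < E / (α + 1) := div_pos h.pos (by linarith [hα.1])
  have h2 : 0 < E / (-α + 1) := div_pos h.pos (by linarith [hα.2])
  refine ⟨-a, c, by linarith, by linarith, hc, hc1,
    ⟨-(E / (-α + 1)), E / (-α + 1), by linarith, fun x hx => ?_⟩,
    ⟨E / (α + 1), E / (α + 1), h1, fun x hx => ?_⟩⟩
  · rw [← minimaxError_neg, hL (-x) ⟨by linarith [hx.2], by linarith [hx.1]⟩]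
    ring
  · rw [hR x hx]
    ring

/-! ### Endpoints -/

/-- A polynomial that has its last critical point, a nondegenerate one, at `1`, with an extremal
value, runs back through the whole range of values to the right of `1`. -/
theorem exists_turning {Q : ℝ[X]} {E u : ℝ} (hE : 0 < E) (hu : u < 1)
    (hle : ∀ x ∈ Icc u 1, |Q.eval x| ≤ E) (h1 : |Q.eval 1| = E) (hd : Q.derivative.eval 1 = 0)
    (hdd : Q.derivative.derivative.eval 1 ≠ 0) (hne : ∀ x, 1 < x → Q.derivative.eval x ≠ 0) :
    ∃ t, 1 < t ∧ Q.eval t = -Q.eval 1 ∧ ∀ x ∈ Icc 1 t, |Q.eval x| ≤ E := by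
  wlog hpos : Q.eval 1 = E generalizing Q with H
  · have hneg : Q.eval 1 = -E := (eq_or_eq_neg_of_abs_eq h1).resolve_left hpos
    obtain ⟨t, ht, ht1, ht2⟩ := H (Q := -Q) (by simpa using hle) (by simpa using h1)
      (by simpa using hd) (by simpa using hdd) (by simpa using hne) (by simp [hneg])
    refine ⟨t, ht, ?_, by simpa using ht2⟩
    simp only [eval_neg] at ht1
    linarith
  obtain ⟨k, hk⟩ := dvd_iff_isRoot.2 hd
  have hval : ∀ x, Q.derivative.eval x = (x - 1) * k.eval x := fun x => by
    rw [hk]; simp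
  have hk1 : k.eval 1 ≠ 0 := by
    rw [hk] at hdd
    simpa using hdd
  -- Otherwise `Q` would be decreasing just before `1` and exceed `E` there. As `k` has no zero
  -- beyond `1`, `Q` then decreases on the whole half-line; being nonconstant, it is unbounded and
  -- passes `-E`.
  have hkneg : k.eval 1 < 0 := by
    refine lt_of_le_of_ne (not_lt.1 fun hkp => ?_) hk1
    obtain ⟨ε, hε, hball⟩ := Metric.eventually_nhds_iff_ball.1
      (k.continuous.continuousAt.eventually (lt_mem_nhds hkp))
    obtain ⟨v, hv1, hv2⟩ : ∃ v, max u (1 - ε) < v ∧ v < 1 := exists_between (max_lt hu (by linarith))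
    have hanti : StrictAntiOn (fun x => Q.eval x) (Icc v 1) := by
      refine strictAntiOn_of_deriv_neg (convex_Icc v 1) Q.continuous.continuousOn fun x hx => ?_
      rw [interior_Icc] at hx
      rw [Polynomial.deriv, hval]
      refine mul_neg_of_neg_of_pos (by linarith [hx.2]) (hball x ?_)
      rw [Metric.mem_ball, Real.dist_eq, abs_lt]
      constructor <;> linarith [hx.1, hx.2, (le_max_right u (1 - ε)).trans_lt hv1]
    have h2 := hanti ⟨le_rfl, hv2.le⟩ ⟨hv2.le, le_rfl⟩ hv2
    have h3 := (abs_le.1 (hle v ⟨((le_max_left _ _).trans_lt hv1).le, hv2.le⟩)).2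
    simp only at h2
    linarith
  have hkn : ∀ x, 1 < x → k.eval x < 0 := by
    intro x hx
    by_contra hcon
    obtain ⟨y, hy, hy0⟩ := intermediate_value_Icc hx.le k.continuous.continuousOn
      ⟨hkneg.le, not_lt.1 hcon⟩
    have hy1 : y ≠ 1 := by
      rintro rfl
      exact hk1 hy0
    refine hne y (lt_of_le_of_ne hy.1 hy1.symm) ?_
    rw [hval, show k.eval y = 0 from hy0, mul_zero]
  have hanti : StrictAntiOn (fun x => Q.eval x) (Ici 1) := by
    refine strictAntiOn_of_deriv_neg (convex_Ici 1) Q.continuous.continuousOn fun x hx => ?_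
    rw [interior_Ici] at hx
    rw [Polynomial.deriv, hval]
    exact mul_neg_of_pos_of_neg (sub_pos.2 hx) (hkn x hx)
  have hdeg : 0 < Q.degree := by
    rw [← natDegree_pos_iff_degree_pos, Nat.pos_iff_ne_zero]
    intro h0
    rw [derivative_of_natDegree_zero h0] at hdd
    simp at hdd
  obtain ⟨y, hyE, hy1⟩ := ((Q.abs_tendsto_atTop hdeg).eventually_gt_atTop E |>.and
    (eventually_gt_atTop 1)).exists
  have hyneg : Q.eval y < -E := by
    have := hanti (self_mem_Ici) (mem_Ici.2 hy1.le) hy1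
    simp only at this
    rcases lt_abs.1 hyE with hh | hh <;> linarith
  obtain ⟨t, ht, ht0⟩ := intermediate_value_Icc' hy1.le Q.continuous.continuousOn
    ⟨hyneg.le, by linarith⟩
  simp only at ht0
  have ht1 : 1 < t := by
    refine lt_of_le_of_ne ht.1 ?_
    rintro rfl
    linarith
  refine ⟨t, ht1, by rw [ht0, hpos], fun x hx => ?_⟩
  have h2 : Q.eval x ≤ Q.eval 1 := hanti.antitoneOn self_mem_Ici (mem_Ici.2 hx.1) hx.1
  have h3 : Q.eval t ≤ Q.eval x := hanti.antitoneOn (mem_Ici.2 hx.1) (mem_Ici.2 ht1.le) hx.2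
  rw [abs_le]
  constructor <;> linarith

/-- The minimax error does not continue linearly beyond a corner for which the right endpoint of
the interval is one of only `n + 2` extremal points. -/
theorem Optimal.minimaxError_ne {n : ℕ} {α E x : ℝ} {p : ℝ[X]} (h : Optimal n α p E)
    (hα : α ∈ Ioo (-1 : ℝ) 1) (h1 : 1 ∈ extr α p E) (hcard : (extr α p E).card ≤ n + 2)
    (hx : α < x) : minimaxError n x ≠ E / (α + 1) * (x + 1) := by
  intro he
  have hα1 : 0 < α + 1 := by linarith [hα.1]
  set s := (x + 1) / (α + 1) with hs
  have hs1 : 1 < s := by rw [hs, lt_div_iff₀ hα1]; linarith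
  have hs0 : 0 < s := by linarith
  have hxs : s * (α + 1) - 1 = x := by rw [hs, div_mul_cancel₀ _ hα1.ne']; ring
  have heE : minimaxError n x = s * E := by rw [he, hs]; ring
  have herr : ∀ y, err x (scalePoly s p) y = s * err α p ((y + 1) / s - 1) := by
    intro y
    have hy : y = s * (((y + 1) / s - 1) + 1) - 1 := by field_simp; ring
    conv_lhs => rw [hy, ← hxs]
    rw [err_scalePoly hs0]
  have hin : ∀ y ∈ Icc (-1 : ℝ) 1, (y + 1) / s - 1 ∈ Ico (-1 : ℝ) 1 := by
    intro y hy
    constructor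
    · have : 0 ≤ (y + 1) / s := div_nonneg (by linarith [hy.1]) hs0.le
      linarith
    · have : (y + 1) / s < 2 := by rw [div_lt_iff₀ hs0]; linarith [hy.2]
      linarith
  have hnorm : ‖checkmark x - (scalePoly s p).toContinuousMapOn (Icc (-1 : ℝ) 1)‖ ≤
      minimaxError n x := by
    refine norm_sub_le_iff.2 fun y hy => ?_
    rw [herr, abs_mul, abs_of_pos hs0, heE]
    exact mul_le_mul_of_nonneg_left (h.abs_err_le _ (Ico_subset_Icc_self (hin y hy))) hs0.le
  have hmem : scalePoly s p ∈ degreeLE ℝ n :=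
    mem_degreeLE_iff.2 ((natDegree_scalePoly_le s p).trans h.natDegree_le)
  have hmin : IsMinimax n x (scalePoly s p) :=
    ⟨hmem, fun q hq => hnorm.trans ((minimaxPoly_isMinimax n x).2 q hq)⟩
  have hnorm' : ‖checkmark x - (scalePoly s p).toContinuousMapOn (Icc (-1 : ℝ) 1)‖ = s * E :=
    heE ▸ le_antisymm hnorm ((minimaxPoly_isMinimax n x).2 _ hmem)
  have hopt := hmin.optimal (hnorm' ▸ mul_pos hs0 h.pos)
  rw [hnorm'] at hopt
  obtain ⟨y, hy⟩ := hopt.alternates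
  -- Linear continuation would make the stretched polynomial optimal for `x`. Its alternation,
  -- pulled back, consists of `n + 2` extremal points of the original error, all less than `1`; but
  -- `1` is itself one of only `n + 2`.
  let v : Fin (n + 2) → ℝ := fun i => (y i + 1) / s - 1
  have hv : ∀ i, v i ∈ extr α p E := by
    intro i
    refine h.mem_extr.2 ⟨Ico_subset_Icc_self (hin _ (hy.mem i)), ?_⟩
    have := hy.abs_err hopt.pos.le i
    rw [herr, abs_mul, abs_of_pos hs0] at this
    exact mul_left_cancel₀ hs0.ne' this
  have hvinj : Function.Injective v := by
    intro i j hij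
    have h2 : (y i + 1) / s = (y j + 1) / s := by simpa [v] using hij
    rw [div_left_inj' hs0.ne'] at h2
    exact hy.strictMono.injective (by linarith)
  have hsub : Finset.univ.image v ⊆ (extr α p E).erase 1 := by
    intro w hw
    obtain ⟨i, -, rfl⟩ := Finset.mem_image.1 hw
    exact Finset.mem_erase.2 ⟨(hin _ (hy.mem i)).2.ne, hv i⟩
  have hle := Finset.card_le_card hsub
  rw [Finset.card_image_of_injective _ hvinj, Finset.card_erase_of_mem h1] at hle
  simp at hle
  omega

/-- An endpoint and a critical point coincide, so at most `n + 2` candidates remain, and all are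
needed. -/
theorem Optimal.extr_eq_of_one_mem_crit {n : ℕ} {α E : ℝ} {p : ℝ[X]} (h : Optimal n α p E)
    (h1 : 1 ∈ crit α p) :
    extr α p E = insert α (insert (-1) (crit α p)) ∧ n ≤ (crit α p).card ∧
      (extr α p E).card = n + 2 := by
  have hsub := extr_subset α E p
  rw [Finset.insert_eq_of_mem h1] at hsub
  have h2 := Finset.card_insert_le α (insert (-1) (crit α p))
  have h3 := Finset.card_insert_le (-1) (crit α p)
  have h4 := h.card_crit_le
  have h5 := h.le_card_extr
  have h6 := Finset.card_le_card hsub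
  exact ⟨Finset.eq_of_subset_of_card_le hsub (by omega), by omega, by omega⟩

/-- If the right endpoint of the interval is a critical point of the error, the corner is the
right endpoint of a V-shape. -/
theorem Optimal.exists_isVShape_of_one_mem_crit {n : ℕ} {α E : ℝ} {p : ℝ[X]}
    (h : Optimal n α p E) (hα : α ∈ Ioo (-1 : ℝ) 1) (h1 : 1 ∈ crit α p) :
    ∃ a b, IsVShape (minimaxError n) a b α := by
  obtain ⟨heq, hcc, hcard⟩ := h.extr_eq_of_one_mem_crit h1
  have hsub : crit α p ⊆ extr α p E := by
    rw [heq]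
    intro x hx
    simp [hx]
  have hα1 : 0 < α + 1 := by linarith [hα.1]
  have hQ : ∀ x, α ≤ x → (X - C α - p).eval x = err α p x := fun x hx => (err_of_ge p hx).symm
  -- All critical points are extremal and so lie in the interval; hence none is beyond `1`.
  obtain ⟨t, ht1, htneg, htle⟩ := exists_turning (Q := X - C α - p) h.pos hα.2
    (fun x hx => by
      rw [hQ x hx.1]
      exact h.abs_err_le x ⟨by linarith [hα.1, hx.1], hx.2⟩)
    (by
      rw [hQ 1 hα.2.le]
      exact (h.mem_extr.1 (hsub h1)).2)
    (by
      rw [derivative_right]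
      rcases h.mem_crit.1 h1 with hc | hc
      · linarith [hc.1, hα.2]
      · rw [hc.2, sub_self])
    (by
      have := h.derivative_derivative_ne_zero_of_card_eq h1 hcc
      simpa using this)
    (fun x hx h0 => by
      rw [derivative_right] at h0
      have := (h.mem_extr.1 (hsub (h.mem_crit.2 (Or.inr ⟨hα.2.trans hx, by linarith⟩)))).1.2
      linarith)
  rw [hQ t (by linarith [hα.2]), hQ 1 hα.2.le] at htneg
  have hle : ∀ x, -1 ≤ x → x ≤ t → |err α p x| ≤ E := by
    intro x hx hxt
    rcases le_total x 1 with hx1 | hx1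
    · exact h.abs_err_le x ⟨hx, hx1⟩
    · rw [← hQ x (hα.2.le.trans hx1)]
      exact htle x ⟨hx1, hxt⟩
  have htp : 0 < t + 1 := by linarith
  have hZ := h.alternates_orderEmb hα hsub (N := n + 1) hcard
  set Z := (extr α p E).orderEmbOfFin hcard
  have hscale : ∀ s, 2 / (t + 1) ≤ s → s ≤ 1 →
      Optimal n (s * (α + 1) - 1) (scalePoly s p) (s * E) := by
    intro s hs hs1
    have hs0 : 0 < s := (div_pos two_pos htp).trans_le hs
    rw [div_le_iff₀ htp] at hs
    refine Alternates.scale hZ.strictMono (fun i => (hZ.mem i).1) h.pos h.natDegree_le hs0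
      (fun i => ?_) hZ.sign fun x hx hxs => hle x hx ?_
    · nlinarith [(hZ.mem i).1, (hZ.mem i).2]
    · by_contra hcon
      have := mul_lt_mul_of_pos_left (add_lt_add_left (not_le.1 hcon) 1) hs0
      linarith
  -- The ratio that carries `t` to `1`. There the turning point joins the `n + 2` old extremal
  -- points, so the shrunken corner `β` is a tip.
  set σ := 2 / (t + 1) with hσ
  have hσ0 : 0 < σ := div_pos two_pos htp
  have hσ1 : σ < 1 := by rw [hσ, div_lt_one htp]; linarith
  have hσt : σ * (t + 1) = 2 := div_mul_cancel₀ _ htp.ne'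
  have hopt := hscale σ le_rfl hσ1.le
  set β := σ * (α + 1) - 1 with hβ
  have hβα : β < α := by nlinarith
  have hβI : β ∈ Ioo (-1 : ℝ) 1 := ⟨by nlinarith, by linarith [hα.2]⟩
  have htE : t ∉ extr α p E := fun hcon => by linarith [(h.mem_extr.1 hcon).1.2]
  have hcard' : n + 3 ≤ (extr β (scalePoly σ p) (σ * E)).card := by
    have hsub' : (insert t (extr α p E)).image (fun x => σ * (x + 1) - 1) ⊆
        extr β (scalePoly σ p) (σ * E) := by
      intro y hy
      obtain ⟨x, hx, rfl⟩ := Finset.mem_image.1 hy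
      have hx' : x ∈ Icc (-1) t ∧ |err α p x| = E := by
        rcases Finset.mem_insert.1 hx with rfl | hx
        · refine ⟨⟨by linarith, le_rfl⟩, ?_⟩
          rw [htneg, abs_neg]
          exact (h.mem_extr.1 (hsub h1)).2
        · have := h.mem_extr.1 hx
          exact ⟨⟨this.1.1, this.1.2.trans ht1.le⟩, this.2⟩
      refine hopt.mem_extr.2 ⟨⟨by nlinarith [hx'.1.1], by nlinarith [hx'.1.2]⟩, ?_⟩
      rw [hβ, err_scalePoly hσ0, abs_mul, abs_of_pos hσ0, hx'.2]
    refine le_trans ?_ (Finset.card_le_card hsub')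
    rw [Finset.card_image_of_injective, Finset.card_insert_of_notMem htE, hcard]
    intro x y hxy
    have : σ * (x + 1) = σ * (y + 1) := by simpa using hxy
    linarith [mul_left_cancel₀ hσ0.ne' this]
  obtain ⟨a, c, hV⟩ := hopt.exists_isVOn_of_card hβI hcard'
  have haff : ∀ x ∈ Icc β α, minimaxError n x = E / (α + 1) * x + E / (α + 1) := by
    intro x hx
    have hxs : (x + 1) / (α + 1) * (α + 1) - 1 = x := by
      rw [div_mul_cancel₀ _ hα1.ne']; ring
    have := hscale ((x + 1) / (α + 1)) (by rw [le_div_iff₀ hα1]; linarith [hx.1])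
      (by rw [div_le_one hα1]; linarith [hx.2])
    rw [hxs] at this
    rw [this.eq_minimax.2]
    ring
  have hV' : IsVOn (minimaxError n) a β α :=
    ⟨hV.left_mem, hV.left_lt, hβα, hα.2.le, hV.decreasing,
      E / (α + 1), E / (α + 1), div_pos h.pos hα1, haff⟩
  obtain ⟨a', c', -, hc, hshape⟩ := hV'.exists_isVShape (continuous_minimaxError n)
  -- A maximal V reaching beyond `α` would continue the linear formula, against
  -- `Optimal.minimaxError_ne`.
  rcases hc.eq_or_lt with rfl | hlt
  · exact ⟨a', β, hshape⟩
  exfalso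
  obtain ⟨m, k, -, hi⟩ := hshape.1.increasing
  obtain ⟨rfl, rfl⟩ := affine_unique hβα fun x hx =>
    (haff x hx).symm.trans (hi x ⟨hx.1, hx.2.trans hc⟩)
  refine h.minimaxError_ne hα (hsub h1) hcard.le hlt ?_
  rw [hi c' ⟨hβα.le.trans hc, le_rfl⟩]
  ring

theorem Optimal.exists_isVShape_of_neg_one_mem_crit {n : ℕ} {α E : ℝ} {p : ℝ[X]}
    (h : Optimal n α p E) (hα : α ∈ Ioo (-1 : ℝ) 1) (h1 : -1 ∈ crit α p) :
    ∃ b c, IsVShape (minimaxError n) α b c := by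
  obtain ⟨a, b, hV⟩ := h.reflect.exists_isVShape_of_one_mem_crit
    ⟨by linarith [hα.2], by linarith [hα.1]⟩ (by
      rw [h.crit_comp_neg, Finset.mem_map_equiv]
      simpa using h1)
  have := hV.reflect (minimaxError_neg n)
  rw [neg_neg] at this
  exact ⟨_, _, this⟩

/-! ### Dependence on the coefficients -/

/-- The polynomial with coefficients `c`. -/
noncomputable def toPoly (n : ℕ) : (Fin (n + 1) → ℝ) →ₗ[ℝ] ℝ[X] :=
  Fintype.linearCombination ℝ fun j : Fin (n + 1) => (X ^ (j : ℕ) : ℝ[X])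

theorem toPoly_apply {n : ℕ} (c : Fin (n + 1) → ℝ) : toPoly n c = ∑ j, c j • X ^ (j : ℕ) := rfl

theorem coeff_toPoly {n : ℕ} (c : Fin (n + 1) → ℝ) (j : Fin (n + 1)) :
    (toPoly n c).coeff j = c j := by
  rw [toPoly_apply, finsetSum_coeff, Finset.sum_eq_single j]
  · simp
  · intro i _ hij
    rw [coeff_smul, coeff_X_pow, if_neg (fun h => hij (Fin.ext h.symm)), smul_zero]
  · simp

theorem natDegree_toPoly_le {n : ℕ} (c : Fin (n + 1) → ℝ) : (toPoly n c).natDegree ≤ n := by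
  rw [toPoly_apply]
  refine natDegree_sum_le_of_forall_le _ _ fun j _ => (natDegree_smul_le _ _).trans ?_
  rw [natDegree_X_pow]
  omega

theorem toPoly_coeff {n : ℕ} {p : ℝ[X]} (hp : p.natDegree ≤ n) :
    toPoly n (fun j => p.coeff j) = p := by
  ext k
  rcases lt_or_ge k (n + 1) with hk | hk
  · exact coeff_toPoly _ ⟨k, hk⟩
  · rw [coeff_eq_zero_of_natDegree_lt (lt_of_le_of_lt (natDegree_toPoly_le _) hk),
      coeff_eq_zero_of_natDegree_lt (lt_of_le_of_lt hp hk)]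

theorem toPoly_injective (n : ℕ) : Function.Injective (toPoly n) := by
  intro c c' h
  funext j
  rw [← coeff_toPoly c, h, coeff_toPoly]

/-- The operator `D` is a parameter so that the polynomial and its derivatives are treated at once.
-/
theorem contDiff_eval_toPoly {n : ℕ} (D : ℝ[X] →ₗ[ℝ] ℝ[X]) :
    ContDiff ℝ ω fun w : (Fin (n + 1) → ℝ) × ℝ => (D (toPoly n w.1)).eval w.2 := by
  have : (fun w : (Fin (n + 1) → ℝ) × ℝ => (D (toPoly n w.1)).eval w.2) =
      fun w => ∑ j : Fin (n + 1), w.1 j * (D (X ^ (j : ℕ))).eval w.2 := by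
    funext w
    rw [toPoly_apply, map_sum, eval_finsetSum]
    refine Finset.sum_congr rfl fun j _ => ?_
    rw [map_smul, eval_smul, smul_eq_mul]
  rw [this]
  refine ContDiff.sum fun j _ => ContDiff.mul ?_ ?_
  · exact (contDiff_apply ℝ ℝ j).comp contDiff_fst
  · exact (AnalyticOnNhd.eval_polynomial _).contDiff.comp contDiff_snd

/-- The coefficients of the minimax polynomial. -/
noncomputable def coeffs (n : ℕ) (α : ℝ) : Fin (n + 1) → ℝ := fun j => (minimaxPoly n α).coeff j

theorem toPoly_coeffs (n : ℕ) (α : ℝ) : toPoly n (coeffs n α) = minimaxPoly n α :=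
  toPoly_coeff (mem_degreeLE_iff.1 (minimaxPoly_isMinimax n α).1)

/-- The coefficients of the minimax polynomial depend continuously on the corner. -/
theorem tendsto_coeffs (n : ℕ) {α₀ : ℝ} (hα₀ : α₀ ∈ Ioo (-1 : ℝ) 1) :
    Tendsto (coeffs n) (𝓝 α₀) (𝓝 (coeffs n α₀)) := by
  let T : (Fin (n + 1) → ℝ) →ₗ[ℝ] C(Icc (-1 : ℝ) 1, ℝ) :=
    (toContinuousMapOnAlgHom (R := ℝ) (Icc (-1 : ℝ) 1)).toLinearMap ∘ₗ toPoly n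
  have hT : ∀ c, T c = (toPoly n c).toContinuousMapOn (Icc (-1 : ℝ) 1) := fun c => rfl
  have hTα : ∀ α, T (coeffs n α) = (minimaxPoly n α).toContinuousMapOn (Icc (-1 : ℝ) 1) := by
    intro α
    rw [hT, toPoly_coeffs]
  have hker : LinearMap.ker T = ⊥ := by
    rw [LinearMap.ker_eq_bot']
    intro c hc
    have h0 : toPoly n c = 0 := by
      refine eq_of_infinite_eval_eq _ _ ((Icc_infinite (show (-1 : ℝ) < 1 by norm_num)).mono
        fun x hx => ?_)
      have := congrArg (fun f : C(Icc (-1 : ℝ) 1, ℝ) => f ⟨x, hx⟩) hc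
      simpa [hT] using this
    exact toPoly_injective n (h0.trans (map_zero _).symm)
  have hTc : Continuous T := T.continuous_of_finiteDimensional
  obtain ⟨K, hK, hanti⟩ := T.exists_antilipschitzWith hker
  have hmin : ∀ α c, ‖checkmark α - T (coeffs n α)‖ ≤ ‖checkmark α - T c‖ := by
    intro α c
    rw [hTα, hT]
    exact (minimaxPoly_isMinimax n α).2 _ (mem_degreeLE_iff.2 (natDegree_toPoly_le c))
  have hbound : ∀ᶠ α in 𝓝 α₀, coeffs n α ∈
      Metric.closedBall (0 : Fin (n + 1) → ℝ) (K * (2 * (‖checkmark α₀‖ + 1))) := by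
    have hev : ∀ᶠ α in 𝓝 α₀, ‖checkmark α‖ < ‖checkmark α₀‖ + 1 :=
      (continuous_checkmark.norm.continuousAt (x := α₀)).eventually (gt_mem_nhds (by simp))
    filter_upwards [hev] with α hα
    rw [mem_closedBall_zero_iff]
    have h1 := hanti.le_mul_dist (coeffs n α) 0
    rw [map_zero, dist_zero_right, dist_zero_right] at h1
    have h2 := hmin α 0
    rw [map_zero, sub_zero] at h2
    have h3 := norm_sub_norm_le (T (coeffs n α)) (checkmark α)
    rw [norm_sub_rev] at h3
    exact h1.trans (mul_le_mul_of_nonneg_left (by linarith) K.2)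
  -- The coefficients stay bounded, and every cluster point gives a best approximation for `α₀`;
  -- uniqueness leaves only one.
  refine (isCompact_closedBall _ _).tendsto_nhds_of_unique_mapClusterPt hbound fun c _ hc => ?_
  obtain ⟨U, hU, hUc⟩ := mapClusterPt_iff_ultrafilter.1 hc
  have hle : ‖checkmark α₀ - T c‖ ≤ ‖checkmark α₀ - T (coeffs n α₀)‖ := by
    have hch : Tendsto checkmark U (𝓝 (checkmark α₀)) :=
      continuous_checkmark.continuousAt.tendsto.mono_left hU
    have hl : Tendsto (fun α => ‖checkmark α - T (coeffs n α)‖) U (𝓝 ‖checkmark α₀ - T c‖) :=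
      (hch.sub ((hTc.tendsto c).comp hUc)).norm
    have hr : Tendsto (fun α => ‖checkmark α - T (coeffs n α₀)‖) U
        (𝓝 ‖checkmark α₀ - T (coeffs n α₀)‖) := (hch.sub tendsto_const_nhds).norm
    exact le_of_tendsto_of_tendsto' hl hr fun α => hmin α _
  have hcm : IsMinimax n α₀ (toPoly n c) := by
    refine ⟨mem_degreeLE_iff.2 (natDegree_toPoly_le c), fun q hq => ?_⟩
    rw [← hT]
    refine hle.trans ?_
    rw [hTα]
    exact (minimaxPoly_isMinimax n α₀).2 q hq
  have := (minimaxPoly_isMinimax n α₀).unique hcm (minimaxError_pos n hα₀)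
  rw [← toPoly_coeffs] at this
  exact (toPoly_injective n this).symm

/-! ### Implicit functions -/

/-- A continuous solution of a nondegenerate finite-dimensional system of analytic equations is
analytic. -/
theorem analyticAt_of_implicit {F G : Type*} [NormedAddCommGroup F] [NormedSpace ℝ F]
    [FiniteDimensional ℝ F] [NormedAddCommGroup G] [NormedSpace ℝ G] [FiniteDimensional ℝ G]
    (hdim : Module.finrank ℝ F = Module.finrank ℝ G) {Φ : ℝ × F → G} {u : ℝ → F} {a : ℝ}
    (hΦ : ContDiffAt ℝ ω Φ (a, u a)) (hinj : ∀ v, fderiv ℝ Φ (a, u a) (0, v) = 0 → v = 0)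
    (hu : Tendsto u (𝓝 a) (𝓝 (u a))) (h0 : ∀ᶠ x in 𝓝 a, Φ (x, u x) = 0) :
    AnalyticAt ℝ u a := by
  have : CompleteSpace F := FiniteDimensional.complete ℝ F
  have : CompleteSpace G := FiniteDimensional.complete ℝ G
  let L : F →L[ℝ] G := fderiv ℝ Φ (a, u a) ∘L ContinuousLinearMap.inr ℝ ℝ F
  have hL : Function.Injective L.toLinearMap := by
    rw [← LinearMap.ker_eq_bot, LinearMap.ker_eq_bot']
    exact fun v hv => hinj v hv
  have hinv : L.IsInvertible :=
    ⟨(LinearEquiv.ofInjectiveOfFinrankEq L.toLinearMap hL hdim).toContinuousLinearEquiv, by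
      ext v; rfl⟩
  have hω : (ω : WithTop ℕ∞) ≠ 0 := by simp
  have han := (hΦ.contDiffAt_implicitFunction hω hinv).analyticAt
  refine han.congr ?_
  have hev := hΦ.eventually_apply_eq_iff_implicitFunction hω hinv
  have ht : Tendsto (fun x => (x, u x)) (𝓝 a) (𝓝 (a, u a)) := tendsto_id.prodMk_nhds hu
  have hbase : Φ (a, u a) = 0 := h0.self_of_nhds
  filter_upwards [ht.eventually hev, h0] with x hx hx0
  exact hx.1 (hx0.trans hbase.symm)

/-! ### The system of equations for an alternation -/

/-- The equation that singles out the alternation point near `x` when the corner is near `α₀`: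
endpoints are fixed, the corner moves along, and all other points are critical. -/
noncomputable def pointEq (α₀ x α : ℝ) (p : ℝ[X]) (y : ℝ) : ℝ :=
  if x = -1 ∨ x = 1 then y - x else if x = α₀ then y - α
    else Real.sign (x - α₀) - p.derivative.eval y

/-- The equations for the coefficients, the signed error and the points of an alternation near
`z`. -/
noncomputable def system (n : ℕ) (α₀ : ℝ) (z : Fin (n + 2) → ℝ)
    (w : ℝ × ((Fin (n + 1) → ℝ) × ℝ × (Fin (n + 2) → ℝ))) :
    (Fin (n + 2) → ℝ) × (Fin (n + 2) → ℝ) :=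
  -- The side of the corner is frozen at its value for `α₀`, which makes the equations polynomial.
  -- For the corner itself `Real.sign 0 = 0` removes the term, as it should since the point moves
  -- with the corner.
  (fun i => Real.sign (z i - α₀) * (w.2.2.2 i - w.1) - (toPoly n w.2.1).eval (w.2.2.2 i) -
      (-1) ^ (i : ℕ) * w.2.2.1,
    fun i => pointEq α₀ (z i) w.1 (toPoly n w.2.1) (w.2.2.2 i))

theorem contDiff_system (n : ℕ) (α₀ : ℝ) (z : Fin (n + 2) → ℝ) :
    ContDiff ℝ ω (system n α₀ z) := by
  have hy : ∀ i, ContDiff ℝ ω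
      fun w : ℝ × ((Fin (n + 1) → ℝ) × ℝ × (Fin (n + 2) → ℝ)) => w.2.2.2 i := fun i =>
    (contDiff_apply ℝ ℝ i).comp (contDiff_snd.comp (contDiff_snd.comp contDiff_snd))
  have hD : ∀ (D : ℝ[X] →ₗ[ℝ] ℝ[X]) i, ContDiff ℝ ω
      fun w : ℝ × ((Fin (n + 1) → ℝ) × ℝ × (Fin (n + 2) → ℝ)) =>
        (D (toPoly n w.2.1)).eval (w.2.2.2 i) := fun D i =>
    (contDiff_eval_toPoly D).comp ((contDiff_fst.comp contDiff_snd).prodMk (hy i))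
  refine ContDiff.prodMk (contDiff_pi.2 fun i => ?_) (contDiff_pi.2 fun i => ?_)
  · exact ((contDiff_const.mul ((hy i).sub contDiff_fst)).sub (hD LinearMap.id i)).sub
      (contDiff_const.mul (contDiff_fst.comp (contDiff_snd.comp contDiff_snd)))
  · unfold pointEq
    split_ifs
    · exact (hy i).sub contDiff_const
    · exact (hy i).sub contDiff_fst
    · exact contDiff_const.sub (hD derivative i)

/-- Injectivity of the linearised system can be tested along lines, so coefficients and evaluation
point are moved together in one direction. -/
theorem hasDerivAt_eval_toPoly_line {n : ℕ} (D : ℝ[X] →ₗ[ℝ] ℝ[X]) (c d : Fin (n + 1) → ℝ)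
    (y v : ℝ) : HasDerivAt (fun t : ℝ => (D (toPoly n (c + t • d))).eval (y + t * v))
      ((D (toPoly n c)).derivative.eval y * v + (D (toPoly n d)).eval y) 0 := by
  have hline : HasDerivAt (fun t : ℝ => y + t * v) v 0 := by
    simpa using ((hasDerivAt_id (0 : ℝ)).mul_const v).const_add y
  have h1 : HasDerivAt (fun t : ℝ => (D (toPoly n c)).eval (y + t * v))
      ((D (toPoly n c)).derivative.eval y * v) 0 :=
    HasDerivAt.comp_of_eq 0 ((D (toPoly n c)).hasDerivAt y) hline (by simp)
  have h2 : HasDerivAt (fun t : ℝ => (D (toPoly n d)).eval (y + t * v))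
      ((D (toPoly n d)).derivative.eval y * v) 0 :=
    HasDerivAt.comp_of_eq 0 ((D (toPoly n d)).hasDerivAt y) hline (by simp)
  have h3 := h1.add ((hasDerivAt_id (0 : ℝ)).mul h2)
  refine (h3.congr_of_eventuallyEq (Eventually.of_forall fun t => ?_)).congr_deriv ?_
  · simp
  · simp

/-- The nondegenerate configurations: there are exactly `n + 2` extremal points, the corner and
the endpoints are not critical, and all critical extremal points are nondegenerate. -/
structure Regular (n : ℕ) (α₀ : ℝ) (z : Fin (n + 2) → ℝ) : Prop where
  alternates : Alternates α₀ (minimaxPoly n α₀) (minimaxError n α₀) z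
  exhaust : ∀ x ∈ Icc (-1 : ℝ) 1,
    |err α₀ (minimaxPoly n α₀) x| = minimaxError n α₀ → ∃ i, z i = x
  left : (minimaxPoly n α₀).derivative.eval (-1) ≠ -1
  right : (minimaxPoly n α₀).derivative.eval 1 ≠ 1
  corner : (minimaxPoly n α₀).derivative.eval α₀ ≠ 1 ∧ (minimaxPoly n α₀).derivative.eval α₀ ≠ -1
  nondegenerate : ∀ i, IsCrit α₀ (minimaxPoly n α₀) (z i) →
    (minimaxPoly n α₀).derivative.derivative.eval (z i) ≠ 0

theorem IsCrit.sign_sub {α x : ℝ} {p : ℝ[X]} (h : IsCrit α p x) :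
    Real.sign (x - α) = p.derivative.eval x := by
  rcases h with h | h
  · rw [Real.sign_of_neg (by linarith [h.1]), h.2]
  · rw [Real.sign_of_pos (by linarith [h.1]), h.2]

theorem Regular.isCrit {n : ℕ} {α₀ : ℝ} {z : Fin (n + 2) → ℝ} (h : Regular n α₀ z)
    (hα₀ : α₀ ∈ Ioo (-1 : ℝ) 1) {i : Fin (n + 2)} (h1 : ¬ (z i = -1 ∨ z i = 1))
    (h2 : z i ≠ α₀) : IsCrit α₀ (minimaxPoly n α₀) (z i) := by
  rw [not_or] at h1
  exact (optimal_minimaxPoly n hα₀).isCrit ⟨lt_of_le_of_ne (h.alternates.mem i).1 (Ne.symm h1.1),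
    lt_of_le_of_ne (h.alternates.mem i).2 h1.2⟩ h2
    (h.alternates.abs_err (minimaxError_pos n hα₀).le i)

/-- For a kernel vector `(d, η, ζ)` the motion of the points does not affect the error to first
order: endpoints and corner do not move, and at the others the derivative of the error is zero. So
the polynomial `d` has the values `-(-1) ^ i * η` at `n + 2` points. Its degree forbids alternation,
hence `η = 0`, then `d = 0` by counting roots, and `ζ = 0` because `p'' ≠ 0`. -/
theorem Regular.fderiv_system_injective {n : ℕ} {α₀ : ℝ} {z : Fin (n + 2) → ℝ}
    (hR : Regular n α₀ z) (hα₀ : α₀ ∈ Ioo (-1 : ℝ) 1) (h₀ : ℝ)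
    (v : (Fin (n + 1) → ℝ) × ℝ × (Fin (n + 2) → ℝ))
    (hv : fderiv ℝ (system n α₀ z) (α₀, coeffs n α₀, h₀, z) (0, v) = 0) : v = 0 := by
  obtain ⟨d, η, ζ⟩ := v
  set u : ℝ × ((Fin (n + 1) → ℝ) × ℝ × (Fin (n + 2) → ℝ)) := (α₀, coeffs n α₀, h₀, z) with hu
  have hf : HasFDerivAt (system n α₀ z) (fderiv ℝ (system n α₀ z) u) u :=
    ((contDiff_system n α₀ z).differentiable (by simp)).differentiableAt.hasFDerivAt
  have hline : HasDerivAt (fun t : ℝ => u + t • ((0 : ℝ), d, η, ζ)) ((0 : ℝ), d, η, ζ) 0 := by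
    simpa using ((hasDerivAt_id (0 : ℝ)).smul_const ((0 : ℝ), d, η, ζ)).const_add u
  have hcomp := HasFDerivAt.comp_hasDerivAt_of_eq (0 : ℝ) hf hline (by simp)
  rw [hv] at hcomp
  have hA : ∀ i, HasDerivAt (fun t : ℝ => (system n α₀ z (u + t • ((0 : ℝ), d, η, ζ))).1 i) 0 0 :=
    fun i => (hasDerivAt_pi.1 (HasFDerivAt.comp_hasDerivAt (0 : ℝ)
      (hasFDerivAt_fst (𝕜 := ℝ)) hcomp)) i
  have hB : ∀ i, HasDerivAt (fun t : ℝ => (system n α₀ z (u + t • ((0 : ℝ), d, η, ζ))).2 i) 0 0 :=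
    fun i => (hasDerivAt_pi.1 (HasFDerivAt.comp_hasDerivAt (0 : ℝ)
      (hasFDerivAt_snd (𝕜 := ℝ)) hcomp)) i
  have hζline : ∀ i, HasDerivAt (fun t : ℝ => z i + t * ζ i) (ζ i) 0 := fun i => by
    simpa using ((hasDerivAt_id (0 : ℝ)).mul_const (ζ i)).const_add (z i)
  have hA' : ∀ i, (Real.sign (z i - α₀) - (minimaxPoly n α₀).derivative.eval (z i)) * ζ i -
      (toPoly n d).eval (z i) - (-1) ^ (i : ℕ) * η = 0 := by
    intro i
    have hη : HasDerivAt (fun t : ℝ => h₀ + t * η) η 0 := by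
      simpa using ((hasDerivAt_id (0 : ℝ)).mul_const η).const_add h₀
    have h1 := ((((hζline i).sub_const α₀).const_mul (Real.sign (z i - α₀))).sub
      (hasDerivAt_eval_toPoly_line LinearMap.id (coeffs n α₀) d (z i) (ζ i))).sub
      (hη.const_mul ((-1) ^ (i : ℕ)))
    have h2 := (hA i).unique (h1.congr_of_eventuallyEq (Eventually.of_forall fun t => by
      simp [system, hu]))
    simp only [LinearMap.id_apply, toPoly_coeffs] at h2
    linarith
  have hB' : ∀ i, (Real.sign (z i - α₀) - (minimaxPoly n α₀).derivative.eval (z i)) * ζ i = 0 ∧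
      (d = 0 → ζ i = 0) := by
    intro i
    by_cases h1 : z i = -1 ∨ z i = 1
    · have h2 := (hB i).unique (((hζline i).sub_const (z i)).congr_of_eventuallyEq
        (Eventually.of_forall fun t => by simp [system, hu, pointEq, h1]))
      simp [← h2]
    by_cases h2 : z i = α₀
    · have h3 := (hB i).unique (((hζline i).sub_const α₀).congr_of_eventuallyEq
        (Eventually.of_forall fun t => by
          simp only [system, hu, pointEq, if_neg h1, if_pos h2]
          simp))
      simp [← h3]
    · have hc := hR.isCrit hα₀ h1 h2
      refine ⟨by rw [hc.sign_sub, sub_self, zero_mul], fun hd => ?_⟩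
      have h3 := (hB i).unique (((hasDerivAt_eval_toPoly_line derivative (coeffs n α₀) d (z i)
        (ζ i)).const_sub (Real.sign (z i - α₀))).congr_of_eventuallyEq
        (Eventually.of_forall fun t => by
          simp only [system, hu, pointEq, if_neg h1, if_neg h2]
          simp))
      rw [toPoly_coeffs, hd] at h3
      simp at h3
      exact h3.resolve_left (hR.nondegenerate i hc)
  have hval : ∀ i, (toPoly n d).eval (z i) = -((-1) ^ (i : ℕ) * η) := by
    intro i
    have := hA' i
    rw [(hB' i).1] at this
    linarith
  have hη : η = 0 := by
    by_contra hne
    refine not_alternating (natDegree_toPoly_le d) hR.alternates.strictMono fun i => ?_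
    rw [hval, hval]
    have h1 : ((-1 : ℝ) ^ (i : ℕ)) ^ 2 = 1 := by rw [← pow_mul, mul_comm, pow_mul]; simp
    have h2 : 0 < η ^ 2 := by positivity
    simp only [Fin.val_castSucc, Fin.val_succ, pow_succ]
    nlinarith
  have hd : d = 0 := by
    refine toPoly_injective n (Eq.trans ?_ (map_zero _).symm)
    refine eq_zero_of_natDegree_lt_card_of_eval_eq_zero _ hR.alternates.strictMono.injective
      (fun i => ?_) ?_
    · rw [hval, hη]
      simp
    · rw [Fintype.card_fin]
      have := natDegree_toPoly_le d
      omega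
  have hζ : ζ = 0 := funext fun i => (hB' i).2 hd
  rw [hd, hη, hζ]
  rfl

/-! ### Localization of the extremal points -/

theorem tendsto_eval_minimaxPoly (n : ℕ) {α₀ : ℝ} (hα₀ : α₀ ∈ Ioo (-1 : ℝ) 1)
    (D : ℝ[X] →ₗ[ℝ] ℝ[X]) (x : ℝ) :
    Tendsto (fun w : ℝ × ℝ => (D (minimaxPoly n w.1)).eval w.2) (𝓝 (α₀, x))
      (𝓝 ((D (minimaxPoly n α₀)).eval x)) := by
  have h1 : Tendsto (fun w : ℝ × ℝ => (coeffs n w.1, w.2)) (𝓝 (α₀, x)) (𝓝 (coeffs n α₀, x)) :=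
    ((tendsto_coeffs n hα₀).comp (continuous_fst.tendsto (α₀, x))).prodMk_nhds
      (continuous_snd.tendsto (α₀, x))
  have h2 := ((contDiff_eval_toPoly (n := n) D).continuous.tendsto _).comp h1
  simpa only [Function.comp_def, toPoly_coeffs] using h2

theorem tendsto_err_minimaxPoly (n : ℕ) {α₀ : ℝ} (hα₀ : α₀ ∈ Ioo (-1 : ℝ) 1) (x : ℝ) :
    Tendsto (fun w : ℝ × ℝ => err w.1 (minimaxPoly n w.1) w.2) (𝓝 (α₀, x))
      (𝓝 (err α₀ (minimaxPoly n α₀) x)) := by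
  have h1 : Continuous fun w : ℝ × ℝ => |w.2 - w.1| := by fun_prop
  exact (h1.tendsto (α₀, x)).sub (tendsto_eval_minimaxPoly n hα₀ LinearMap.id x)

/-- An extremal point near `z i` is of the same type as `z i`. Near an endpoint or the corner any
other type would be a critical point, which the values of `p'` exclude by continuity. -/
theorem Regular.eventually_pointEq {n : ℕ} {α₀ : ℝ} {z : Fin (n + 2) → ℝ} (hR : Regular n α₀ z)
    (hα₀ : α₀ ∈ Ioo (-1 : ℝ) 1) (i : Fin (n + 2)) :
    ∀ᶠ w : ℝ × ℝ in 𝓝 (α₀, z i), w.2 ∈ Icc (-1 : ℝ) 1 →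
      |err w.1 (minimaxPoly n w.1) w.2| = minimaxError n w.1 →
      pointEq α₀ (z i) w.1 (minimaxPoly n w.1) w.2 = 0 := by
  have hI : ∀ᶠ w : ℝ × ℝ in 𝓝 (α₀, z i), w.1 ∈ Ioo (-1 : ℝ) 1 :=
    continuousAt_fst.eventually (isOpen_Ioo.mem_nhds hα₀)
  have hd := tendsto_eval_minimaxPoly n hα₀ derivative (z i)
  have hsub : ContinuousAt (fun w : ℝ × ℝ => w.2 - w.1) (α₀, z i) := by fun_prop
  have hsnd : ContinuousAt (fun w : ℝ × ℝ => w.2) (α₀, z i) := continuousAt_snd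
  by_cases h1 : z i = -1 ∨ z i = 1
  · simp only [pointEq, if_pos h1]
    rcases h1 with h1 | h1 <;> rw [h1] at hd hsub hsnd hI ⊢
    · have e1 := hd.eventually_ne hR.left
      have e2 : ∀ᶠ w : ℝ × ℝ in 𝓝 (α₀, -1), w.2 - w.1 < 0 :=
        hsub.eventually (gt_mem_nhds (show (-1 : ℝ) - α₀ < 0 by linarith [hα₀.1]))
      have e3 : ∀ᶠ w : ℝ × ℝ in 𝓝 (α₀, -1), w.2 < 1 :=
        hsnd.eventually (gt_mem_nhds (show (-1 : ℝ) < 1 by norm_num))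
      filter_upwards [hI, e1, e2, e3] with w hw he1 he2 he3 hm hex
      by_contra hne
      have hgt : -1 < w.2 := lt_of_le_of_ne hm.1 fun h => hne (by rw [← h]; ring)
      rcases (optimal_minimaxPoly n hw).isCrit ⟨hgt, he3⟩ (by linarith) hex with hc | hc
      · exact he1 hc.2
      · linarith [hc.1]
    · have e1 := hd.eventually_ne hR.right
      have e2 : ∀ᶠ w : ℝ × ℝ in 𝓝 (α₀, 1), 0 < w.2 - w.1 :=
        hsub.eventually (lt_mem_nhds (show 0 < 1 - α₀ by linarith [hα₀.2]))
      have e3 : ∀ᶠ w : ℝ × ℝ in 𝓝 (α₀, 1), -1 < w.2 :=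
        hsnd.eventually (lt_mem_nhds (show (-1 : ℝ) < 1 by norm_num))
      filter_upwards [hI, e1, e2, e3] with w hw he1 he2 he3 hm hex
      by_contra hne
      have hgt : w.2 < 1 := lt_of_le_of_ne hm.2 fun h => hne (by rw [h]; ring)
      rcases (optimal_minimaxPoly n hw).isCrit ⟨he3, hgt⟩ (by linarith) hex with hc | hc
      · linarith [hc.1]
      · exact he1 hc.2
  have hzI : z i ∈ Ioo (-1 : ℝ) 1 := by
    rw [not_or] at h1
    exact ⟨lt_of_le_of_ne (hR.alternates.mem i).1 (Ne.symm h1.1),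
      lt_of_le_of_ne (hR.alternates.mem i).2 h1.2⟩
  have hyI : ∀ᶠ w : ℝ × ℝ in 𝓝 (α₀, z i), w.2 ∈ Ioo (-1 : ℝ) 1 :=
    hsnd.eventually (isOpen_Ioo.mem_nhds hzI)
  by_cases h2 : z i = α₀
  · simp only [pointEq, if_neg h1, if_pos h2]
    have hc1 : (derivative (minimaxPoly n α₀)).eval (z i) ≠ 1 := h2.symm ▸ hR.corner.1
    have hc2 : (derivative (minimaxPoly n α₀)).eval (z i) ≠ -1 := h2.symm ▸ hR.corner.2
    filter_upwards [hI, hyI, hd.eventually_ne hc1, hd.eventually_ne hc2]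
      with w hw hy he1 he2 _ hex
    by_contra hne
    rcases (optimal_minimaxPoly n hw).isCrit hy (sub_ne_zero.1 hne) hex with hc | hc
    · exact he2 hc.2
    · exact he1 hc.2
  · simp only [pointEq, if_neg h1, if_neg h2]
    rcases lt_or_gt_of_ne h2 with hlt | hlt
    · have e1 : ∀ᶠ w : ℝ × ℝ in 𝓝 (α₀, z i), w.2 - w.1 < 0 :=
        hsub.eventually (gt_mem_nhds (sub_neg.2 hlt))
      filter_upwards [hI, hyI, e1] with w hw hy he1 _ hex
      have hc := (optimal_minimaxPoly n hw).isCrit hy (by linarith) hex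
      rw [Real.sign_of_neg (sub_neg.2 hlt), ← hc.sign_sub, Real.sign_of_neg he1, sub_self]
    · have e1 : ∀ᶠ w : ℝ × ℝ in 𝓝 (α₀, z i), 0 < w.2 - w.1 :=
        hsub.eventually (lt_mem_nhds (sub_pos.2 hlt))
      filter_upwards [hI, hyI, e1] with w hw hy he1 _ hex
      have hc := (optimal_minimaxPoly n hw).isCrit hy (by linarith) hex
      rw [Real.sign_of_pos (sub_pos.2 hlt), ← hc.sign_sub, Real.sign_of_pos he1, sub_self]

theorem exists_ball_of_eventually_nhds_prod {P : ℝ × ℝ → Prop} {a x : ℝ}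
    (h : ∀ᶠ w in 𝓝 (a, x), P w) :
    ∃ δ > 0, ∀ᶠ α in 𝓝 a, ∀ y ∈ Metric.ball x δ, P (α, y) := by
  rw [nhds_prod_eq, Filter.eventually_prod_iff] at h
  obtain ⟨pa, ha, pb, hb, hab⟩ := h
  obtain ⟨δ, hδ, hball⟩ := Metric.eventually_nhds_iff_ball.1 hb
  exact ⟨δ, hδ, ha.mono fun α hα y hy => hab hα (hball y hy)⟩

/-- Two solutions near a critical `z i` would give a zero of `p''` between them by Rolle. So there
is at most one extremal point near each `z i`. -/
theorem Regular.exists_ball {n : ℕ} {α₀ : ℝ} {z : Fin (n + 2) → ℝ} (hR : Regular n α₀ z)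
    (hα₀ : α₀ ∈ Ioo (-1 : ℝ) 1) (i : Fin (n + 2)) :
    ∃ δ > 0, ∀ᶠ α in 𝓝 α₀,
      (∀ y ∈ Metric.ball (z i) δ, y ∈ Icc (-1 : ℝ) 1 →
        |err α (minimaxPoly n α) y| = minimaxError n α →
        pointEq α₀ (z i) α (minimaxPoly n α) y = 0) ∧
      ∀ y ∈ Metric.ball (z i) δ, ∀ y' ∈ Metric.ball (z i) δ, y < y' →
        pointEq α₀ (z i) α (minimaxPoly n α) y = 0 →
        pointEq α₀ (z i) α (minimaxPoly n α) y' ≠ 0 := by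
  obtain ⟨δ, hδ, hev⟩ := exists_ball_of_eventually_nhds_prod (hR.eventually_pointEq hα₀ i)
  by_cases h1 : z i = -1 ∨ z i = 1
  · refine ⟨δ, hδ, hev.mono fun α hα => ⟨hα, fun y _ y' _ hlt h0 h0' => ?_⟩⟩
    simp only [pointEq, if_pos h1] at h0 h0'
    linarith
  by_cases h2 : z i = α₀
  · refine ⟨δ, hδ, hev.mono fun α hα => ⟨hα, fun y _ y' _ hlt h0 h0' => ?_⟩⟩
    simp only [pointEq, if_neg h1, if_pos h2] at h0 h0'
    linarith
  have hdd := tendsto_eval_minimaxPoly n hα₀ (derivative ∘ₗ derivative) (z i)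
  obtain ⟨δ', hδ', hev'⟩ := exists_ball_of_eventually_nhds_prod
    (hdd.eventually_ne (hR.nondegenerate i (hR.isCrit hα₀ h1 h2)))
  refine ⟨min δ δ', lt_min hδ hδ', ?_⟩
  filter_upwards [hev, hev'] with α hα hα'
  refine ⟨fun y hy => hα y (Metric.ball_subset_ball (min_le_left _ _) hy),
    fun y hy y' hy' hlt h0 h0' => ?_⟩
  simp only [pointEq, if_neg h1, if_neg h2] at h0 h0'
  obtain ⟨w, hw, hw0⟩ := exists_hasDerivAt_eq_zero (f := fun x =>
    (minimaxPoly n α).derivative.eval x) hlt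
    (minimaxPoly n α).derivative.continuous.continuousOn (by linarith)
    (fun x _ => (minimaxPoly n α).derivative.hasDerivAt x)
  refine hα' w (Metric.ball_subset_ball (min_le_right δ δ') ?_) hw0
  have hord : (Metric.ball (z i) (min δ δ')).OrdConnected := (convex_ball _ _).ordConnected
  exact hord.out hy hy' (Ioo_subset_Icc_self hw)

/-- On the compact complement of the balls the error is strictly below its maximum, and this
persists for nearby corners. -/
theorem Regular.eventually_extr_subset {n : ℕ} {α₀ : ℝ} {z : Fin (n + 2) → ℝ}
    (hR : Regular n α₀ z) (hα₀ : α₀ ∈ Ioo (-1 : ℝ) 1) {δ : ℝ} (hδ : 0 < δ) :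
    ∀ᶠ α in 𝓝 α₀, ∀ y ∈ Icc (-1 : ℝ) 1, |err α (minimaxPoly n α) y| = minimaxError n α →
      ∃ i, y ∈ Metric.ball (z i) δ := by
  have hK : IsCompact (Icc (-1 : ℝ) 1 \ ⋃ i, Metric.ball (z i) δ) :=
    isCompact_Icc.diff (isOpen_iUnion fun i => Metric.isOpen_ball)
  have hev : ∀ᶠ α in 𝓝 α₀, ∀ y ∈ Icc (-1 : ℝ) 1 \ ⋃ i, Metric.ball (z i) δ,
      |err α (minimaxPoly n α) y| < minimaxError n α := by
    refine hK.eventually_forall_of_forall_eventually fun y hy => ?_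
    have h1 : Tendsto (fun w : ℝ × ℝ => minimaxError n w.1) (𝓝 (α₀, y))
        (𝓝 (minimaxError n α₀)) :=
      ((continuous_minimaxError n).comp continuous_fst).tendsto (α₀, y)
    refine (tendsto_err_minimaxPoly n hα₀ y).abs.eventually_lt h1
      (lt_of_le_of_ne ((optimal_minimaxPoly n hα₀).abs_err_le y hy.1) fun he => ?_)
    obtain ⟨i, rfl⟩ := hR.exhaust y hy.1 he
    exact hy.2 (mem_iUnion.2 ⟨i, Metric.mem_ball_self hδ⟩)
  filter_upwards [hev] with α hα y hy he
  by_contra hcon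
  refine (hα y ⟨hy, fun hmem => hcon ?_⟩).ne he
  exact mem_iUnion.1 hmem

/-- The `n + 2` points lie in `n + 2` separated balls, at most one in each. The assignment of balls
is thus strictly increasing, hence the identity, and no other extremal point has room. -/
theorem Regular.eventually_alternates {n : ℕ} {α₀ : ℝ} {z : Fin (n + 2) → ℝ}
    (hR : Regular n α₀ z) (hα₀ : α₀ ∈ Ioo (-1 : ℝ) 1) {r : ℝ} (hr : 0 < r) :
    ∀ᶠ α in 𝓝 α₀, ∀ y : Fin (n + 2) → ℝ, Alternates α (minimaxPoly n α) (minimaxError n α) y →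
      (∀ i, |y i - z i| < r) ∧ (∀ i, pointEq α₀ (z i) α (minimaxPoly n α) (y i) = 0) ∧
      ∀ w ∈ Icc (-1 : ℝ) 1, |err α (minimaxPoly n α) w| = minimaxError n α → ∃ i, y i = w := by
  choose δ' hδ' hev using hR.exists_ball hα₀
  obtain ⟨δ, hδ, hδδ', hδr, hsep⟩ : ∃ δ > 0, (∀ i, δ < δ' i) ∧ δ < r ∧
      ∀ i j, i < j → 2 * δ < z j - z i := by
    have h1 : ∀ᶠ δ in 𝓝[>] (0 : ℝ), ∀ i, δ < δ' i := eventually_all.2 fun i =>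
      (gt_mem_nhds (hδ' i)).filter_mono nhdsWithin_le_nhds
    have h2 : ∀ᶠ δ in 𝓝[>] (0 : ℝ), δ < r := (gt_mem_nhds hr).filter_mono nhdsWithin_le_nhds
    have h3 : ∀ᶠ δ in 𝓝[>] (0 : ℝ), ∀ i j, i < j → 2 * δ < z j - z i := by
      refine eventually_all.2 fun i => eventually_all.2 fun j => ?_
      by_cases hij : i < j
      · have : 0 < (z j - z i) / 2 := by linarith [hR.alternates.strictMono hij]
        filter_upwards [(gt_mem_nhds this).filter_mono nhdsWithin_le_nhds] with δ hδ _
        linarith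
      · exact Eventually.of_forall fun δ h => absurd h hij
    obtain ⟨δ, ⟨⟨⟨ha, hb⟩, hc⟩, hd⟩⟩ := ((h1.and h2).and h3 |>.and self_mem_nhdsWithin).exists
    exact ⟨δ, hd, ha, hb, hc⟩
  have hI : ∀ᶠ α in 𝓝 α₀, α ∈ Ioo (-1 : ℝ) 1 := isOpen_Ioo.mem_nhds hα₀
  filter_upwards [hI, eventually_all.2 hev, hR.eventually_extr_subset hα₀ hδ] with α hα hloc hcov y hy
  have hye : ∀ i, |err α (minimaxPoly n α) (y i)| = minimaxError n α :=
    hy.abs_err (minimaxError_pos n hα).le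
  have hsub : ∀ i, Metric.ball (z i) δ ⊆ Metric.ball (z i) (δ' i) := fun i =>
    Metric.ball_subset_ball (hδδ' i).le
  have huniq : ∀ i, ∀ v ∈ Metric.ball (z i) δ, ∀ w ∈ Metric.ball (z i) δ,
      v ∈ Icc (-1 : ℝ) 1 → w ∈ Icc (-1 : ℝ) 1 →
      |err α (minimaxPoly n α) v| = minimaxError n α →
      |err α (minimaxPoly n α) w| = minimaxError n α → ¬ v < w :=
    fun i v hv w hw hvI hwI hve hwe hlt => (hloc i).2 v (hsub i hv) w (hsub i hw) hlt
      ((hloc i).1 v (hsub i hv) hvI hve) ((hloc i).1 w (hsub i hw) hwI hwe)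
  choose j hj using fun i => hcov (y i) (hy.mem i) (hye i)
  have hjm : StrictMono j := by
    intro a b hab
    have hlt := hy.strictMono hab
    by_contra hcon
    rcases (not_lt.1 hcon).eq_or_lt with heq | hgt
    · exact huniq (j a) _ (hj a) _ (heq ▸ hj b) (hy.mem a) (hy.mem b) (hye a) (hye b) hlt
    · have h1 := hsep _ _ hgt
      have h2 := abs_lt.1 (Metric.mem_ball.1 (hj a))
      have h3 := abs_lt.1 (Metric.mem_ball.1 (hj b))
      linarith
  have hjid : j = id := by
    refine (StrictMono.range_inj hjm strictMono_id).1 ?_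
    rw [range_id, (Finite.injective_iff_surjective.1 hjm.injective).range_eq]
  rw [hjid] at hj
  refine ⟨fun i => (Metric.mem_ball.1 (hj i)).trans hδr,
    fun i => (hloc i).1 _ (hsub i (hj i)) (hy.mem i) (hye i), fun w hw hwe => ?_⟩
  obtain ⟨i, hi⟩ := hcov w hw hwe
  refine ⟨i, le_antisymm (not_lt.1 ?_) (not_lt.1 ?_)⟩
  · exact huniq i _ hi _ (hj i) hw (hy.mem i) hwe (hye i)
  · exact huniq i _ (hj i) _ hi (hy.mem i) hw (hye i) hwe

/-! ### Analyticity -/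

/-- The only use of the V-shapes: `n + 3` extremal points would make `α₀` a tip, and a critical
point at `1` or `-1` a right or left endpoint. What remains has at least `n - 1` critical points,
enough for the nondegeneracy lemmas. -/
theorem exists_regular {n : ℕ} {α₀ : ℝ} (hα₀ : α₀ ∈ Ioo (-1 : ℝ) 1)
    (hV : ∀ a b c : ℝ, IsVShape (minimaxError n) a b c → α₀ ≠ a ∧ α₀ ≠ b ∧ α₀ ≠ c) :
    ∃ z, Regular n α₀ z := by
  have h := optimal_minimaxPoly n hα₀
  set p := minimaxPoly n α₀ with hp
  set E := minimaxError n α₀ with hE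
  have hcard : (extr α₀ p E).card = n + 2 := by
    refine le_antisymm (not_lt.1 fun hlt => ?_) h.le_card_extr
    obtain ⟨a, c, hVon⟩ := h.exists_isVOn_of_card hα₀ hlt
    obtain ⟨a', c', -, -, hS⟩ := hVon.exists_isVShape (continuous_minimaxError n)
    exact (hV _ _ _ hS).2.1 rfl
  have hr : 1 ∉ crit α₀ p := by
    intro h1
    obtain ⟨a, b, hS⟩ := h.exists_isVShape_of_one_mem_crit hα₀ h1
    exact (hV _ _ _ hS).2.2 rfl
  have hl : -1 ∉ crit α₀ p := by
    intro h1
    obtain ⟨b, c, hS⟩ := h.exists_isVShape_of_neg_one_mem_crit hα₀ h1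
    exact (hV _ _ _ hS).1 rfl
  have hcc : n ≤ (crit α₀ p).card + 1 := by
    have h1 := Finset.card_le_card (extr_subset α₀ E p)
    have h2 := Finset.card_insert_le α₀ (insert (-1) (insert 1 (crit α₀ p)))
    have h3 := Finset.card_insert_le (-1) (insert 1 (crit α₀ p))
    have h4 := Finset.card_insert_le 1 (crit α₀ p)
    omega
  obtain ⟨z, hz⟩ := h.alternates
  refine ⟨z, hz, fun x hx hxe => ?_, fun h1 => hl (h.mem_crit.2 (Or.inl ⟨hα₀.1, h1⟩)),
    fun h1 => hr (h.mem_crit.2 (Or.inr ⟨hα₀.2, h1⟩)),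
    ⟨h.derivative_corner_ne_one hα₀ hcc, h.derivative_corner_ne_neg_one hα₀ hcc⟩, fun i hi => ?_⟩
  · have heq : Finset.univ.image z = extr α₀ p E := by
      refine Finset.eq_of_subset_of_card_le (fun y hy => ?_) ?_
      · obtain ⟨i, -, rfl⟩ := Finset.mem_image.1 hy
        exact h.alternates_mem_extr hz i
      · rw [hcard, Finset.card_image_of_injective _ hz.strictMono.injective]
        simp
    obtain ⟨i, -, hi⟩ := Finset.mem_image.1 (heq ▸ h.mem_extr.2 ⟨hx, hxe⟩)
    exact ⟨i, hi⟩
  · have hic := h.mem_crit.2 hi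
    refine h.derivative_derivative_ne_zero_of_extr hic ⟨lt_of_le_of_ne (hz.mem i).1 ?_,
      lt_of_le_of_ne (hz.mem i).2 ?_⟩ (hz.abs_err h.pos.le i) hcc
    · exact fun h1 => hl (h1 ▸ hic)
    · exact fun h1 => hr (h1 ▸ hic)

open Classical in
/-- A choice of alternation for each corner, extending a given one. -/
noncomputable def altPoints (n : ℕ) (α₀ : ℝ) (z : Fin (n + 2) → ℝ) (α : ℝ) : Fin (n + 2) → ℝ :=
  if h : α ≠ α₀ ∧ ∃ y : Fin (n + 2) → ℝ, Alternates α (minimaxPoly n α) (minimaxError n α) y then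
    h.2.choose else z

theorem altPoints_self {n : ℕ} {α₀ : ℝ} {z : Fin (n + 2) → ℝ} : altPoints n α₀ z α₀ = z := by
  simp [altPoints]

theorem Regular.alternates_altPoints {n : ℕ} {α₀ : ℝ} {z : Fin (n + 2) → ℝ}
    (hR : Regular n α₀ z) {α : ℝ} (hα : α ∈ Ioo (-1 : ℝ) 1) :
    Alternates α (minimaxPoly n α) (minimaxError n α) (altPoints n α₀ z α) := by
  rcases eq_or_ne α α₀ with rfl | hne
  · rw [altPoints_self]
    exact hR.alternates
  · have hex : α ≠ α₀ ∧ ∃ y : Fin (n + 2) → ℝ,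
        Alternates α (minimaxPoly n α) (minimaxError n α) y :=
      ⟨hne, (optimal_minimaxPoly n hα).alternates⟩
    rw [altPoints, dif_pos hex]
    exact hex.2.choose_spec

theorem Alternates.err_eq {α E : ℝ} {p : ℝ[X]} {N : ℕ} {z : Fin (N + 1) → ℝ}
    (h : Alternates α p E z) (i : Fin (N + 1)) :
    err α p (z i) = (-1) ^ (i : ℕ) * err α p (z 0) := by
  obtain ⟨ε, -, hs⟩ := h.sign
  rw [hs, hs]
  simp
  ring

/-- The alternation set is given by any alternation that contains all extremal points. -/
theorem alternationSet_eq_range {n : ℕ} {α : ℝ} (hα : α ∈ Ioo (-1 : ℝ) 1) {y : Fin (n + 2) → ℝ}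
    (hy : Alternates α (minimaxPoly n α) (minimaxError n α) y)
    (hall : ∀ w ∈ Icc (-1 : ℝ) 1, |err α (minimaxPoly n α) w| = minimaxError n α →
      ∃ i, y i = w) : alternationSet n α = range y := by
  ext x
  constructor
  · rintro ⟨N, z, -, hz, i, rfl⟩
    have hz' : Alternates α (minimaxPoly n α) (minimaxError n α) z := ⟨hz.1, hz.2.1, hz.2.2⟩
    exact hall _ (hz'.mem i) (hz'.abs_err (minimaxError_pos n hα).le i)
  · exact fun hx => ⟨n + 2, y, le_rfl, ⟨hy.strictMono, hy.mem, hy.sign⟩, hx⟩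

/-- Although the alternations are chosen arbitrarily, localization makes them continuous at `α₀`.
The second component is the signed error at the first point, since the sign of an alternation is not
prescribed. -/
theorem Regular.analyticAt {n : ℕ} {α₀ : ℝ} {z : Fin (n + 2) → ℝ} (hR : Regular n α₀ z)
    (hα₀ : α₀ ∈ Ioo (-1 : ℝ) 1) :
    AnalyticAt ℝ (fun α => (coeffs n α,
      err α (minimaxPoly n α) (altPoints n α₀ z α 0), altPoints n α₀ z α)) α₀ := by
  have hI : ∀ᶠ α in 𝓝 α₀, α ∈ Ioo (-1 : ℝ) 1 := isOpen_Ioo.mem_nhds hα₀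
  have hzt : Tendsto (altPoints n α₀ z) (𝓝 α₀) (𝓝 z) := by
    rw [tendsto_pi_nhds]
    intro i
    rw [Metric.tendsto_nhds]
    intro r hr
    filter_upwards [hI, hR.eventually_alternates hα₀ hr] with α hα hev
    exact (hev _ (hR.alternates_altPoints hα)).1 i
  have hzi : ∀ i, Tendsto (fun α => altPoints n α₀ z α i) (𝓝 α₀) (𝓝 (z i)) :=
    tendsto_pi_nhds.1 hzt
  refine analyticAt_of_implicit (by simp; ring) (Φ := system n α₀ z)
    (contDiff_system n α₀ z).contDiffAt (fun v hv => ?_) ?_ ?_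
  · simp only [altPoints_self] at hv
    exact hR.fderiv_system_injective hα₀ _ v hv
  · simp only [altPoints_self]
    exact (tendsto_coeffs n hα₀).prodMk_nhds (((tendsto_err_minimaxPoly n hα₀ (z 0)).comp
      (tendsto_id.prodMk_nhds (hzi 0))).prodMk_nhds hzt)
  · have hside : ∀ᶠ α in 𝓝 α₀, ∀ i, z i ≠ α₀ →
        Real.sign (z i - α₀) = Real.sign (altPoints n α₀ z α i - α) := by
      refine eventually_all.2 fun i => ?_
      have ht : Tendsto (fun α => altPoints n α₀ z α i - α) (𝓝 α₀) (𝓝 (z i - α₀)) :=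
        (hzi i).sub tendsto_id
      rcases lt_trichotomy (z i - α₀) 0 with hlt | heq | hgt
      · filter_upwards [ht.eventually (gt_mem_nhds hlt)] with α hα _
        rw [Real.sign_of_neg hlt, Real.sign_of_neg hα]
      · exact Eventually.of_forall fun α hne => absurd (sub_eq_zero.1 heq) hne
      · filter_upwards [ht.eventually (lt_mem_nhds hgt)] with α hα _
        rw [Real.sign_of_pos hgt, Real.sign_of_pos hα]
    filter_upwards [hI, hR.eventually_alternates hα₀ one_pos, hside] with α hα hev hs
    have hy := hR.alternates_altPoints hα
    have hpe := (hev _ hy).2.1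
    refine Prod.ext (funext fun i => ?_) (funext fun i => ?_)
    -- The frozen sign agrees with the actual one near `α₀`; at the corner both sides are zero.
    · have habs : Real.sign (z i - α₀) * (altPoints n α₀ z α i - α) =
          |altPoints n α₀ z α i - α| := by
        by_cases hzα : z i = α₀
        · have h1 := hpe i
          have h2 : ¬ (z i = -1 ∨ z i = 1) := by
            rw [hzα]
            rintro (h | h) <;> linarith [hα₀.1, hα₀.2]
          rw [pointEq, if_neg h2, if_pos hzα] at h1
          rw [h1]
          simp
        · rw [hs i hzα]
          rcases lt_trichotomy (altPoints n α₀ z α i - α) 0 with hlt | heq | hgt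
          · rw [Real.sign_of_neg hlt, abs_of_neg hlt]
            ring
          · rw [heq]
            simp
          · rw [Real.sign_of_pos hgt, abs_of_pos hgt]
            ring
      have h3 := hy.err_eq i
      simp only [system, toPoly_coeffs, habs]
      rw [← h3, err]
      simp
    · simp only [system, toPoly_coeffs]
      exact hpe i

end Checkmark

theorem mainTheorem3 (n : ℕ) (α₀ : ℝ) (hα₀ : α₀ ∈ Set.Ioo (-1 : ℝ) 1)
    (hV : ∀ a b c : ℝ, Checkmark.IsVShape (Checkmark.minimaxError n) a b c →
      α₀ ≠ a ∧ α₀ ≠ b ∧ α₀ ≠ c) :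
    AnalyticAt ℝ (fun α => Checkmark.minimaxError n α) α₀ ∧
    (∃ z : Fin (n + 2) → ℝ → ℝ,
      (∀ i, AnalyticAt ℝ (z i) α₀) ∧
      ∀ᶠ α in 𝓝 α₀, StrictMono (fun i => z i α) ∧
        Checkmark.alternationSet n α = Set.range (fun i => z i α)) ∧
    (∀ j : ℕ, AnalyticAt ℝ (fun α => (Checkmark.minimaxPoly n α).coeff j) α₀) := by
  obtain ⟨z, hR⟩ := Checkmark.exists_regular hα₀ hV
  have han := hR.analyticAt hα₀
  have hI : ∀ᶠ α in 𝓝 α₀, α ∈ Ioo (-1 : ℝ) 1 := isOpen_Ioo.mem_nhds hα₀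
  have hc : AnalyticAt ℝ (Checkmark.coeffs n) α₀ := analyticAt_fst.comp han
  have hh : AnalyticAt ℝ (fun α => Checkmark.err α (Checkmark.minimaxPoly n α)
      (Checkmark.altPoints n α₀ z α 0)) α₀ :=
    analyticAt_fst.comp (analyticAt_snd.comp han)
  have hz : AnalyticAt ℝ (Checkmark.altPoints n α₀ z) α₀ :=
    analyticAt_snd.comp (analyticAt_snd.comp han)
  have habs : ∀ᶠ α in 𝓝 α₀, |Checkmark.err α (Checkmark.minimaxPoly n α)
      (Checkmark.altPoints n α₀ z α 0)| = Checkmark.minimaxError n α := by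
    filter_upwards [hI] with α hα
    exact (hR.alternates_altPoints hα).abs_err (Checkmark.minimaxError_pos n hα).le 0
  refine ⟨?_, ⟨fun i α => Checkmark.altPoints n α₀ z α i, fun i => ?_, ?_⟩, fun j => ?_⟩
  -- The signed error does not vanish at `α₀`, so it keeps its sign nearby and `E_n` is locally plus
  -- or minus an analytic function.
  · have hne : Checkmark.err α₀ (Checkmark.minimaxPoly n α₀)
        (Checkmark.altPoints n α₀ z α₀ 0) ≠ 0 := by
      intro h0
      have := habs.self_of_nhds
      rw [h0, abs_zero] at this
      exact (Checkmark.minimaxError_pos n hα₀).ne this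
    rcases lt_or_gt_of_ne hne with hlt | hgt
    · refine hh.neg.congr ?_
      filter_upwards [habs, hh.continuousAt.eventually (gt_mem_nhds hlt)] with α h1 h2
      rw [← h1, abs_of_neg h2]
      rfl
    · refine hh.congr ?_
      filter_upwards [habs, hh.continuousAt.eventually (lt_mem_nhds hgt)] with α h1 h2
      rw [← h1, abs_of_pos h2]
  · exact ((ContinuousLinearMap.proj (R := ℝ) (φ := fun _ : Fin (n + 2) => ℝ) i).analyticAt _).comp
      hz
  · filter_upwards [hI, hR.eventually_alternates hα₀ one_pos] with α hα hev
    have hy := hR.alternates_altPoints hα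
    exact ⟨hy.strictMono, Checkmark.alternationSet_eq_range hα hy (hev _ hy).2.2⟩
  · rcases lt_or_ge j (n + 1) with hj | hj
    · exact ((ContinuousLinearMap.proj (R := ℝ) (φ := fun _ : Fin (n + 1) => ℝ)
        ⟨j, hj⟩).analyticAt _).comp hc
    · have : (fun α => (Checkmark.minimaxPoly n α).coeff j) = fun _ => 0 := by
        funext α
        exact coeff_eq_zero_of_natDegree_lt (lt_of_le_of_lt (Checkmark.mem_degreeLE_iff.1
          (Checkmark.minimaxPoly_isMinimax n α).1) hj)
      rw [this]
      exact analyticAt_const
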